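/- **Model.** A collocated wireless network has a finite non-empty set $\mathcal K$ of $K$ links; in each slot at most one packet can be transmitted in the whole network. The traffic state $\mathbf x(t)$ is an irreducible Markov chain on a finite set $\mathcal X$; in state $y$, $\tau_{l,d}(y)$ packets with deadline $d\in\{1,\dots,d_{\max}\}$ arrive on link $l$ (the rest of the information in $y$ is hidden). Every link has a positive arrival rate, i.e. for each $l$ there are a state $y$ and a deadline $d$ with $\tau_{l,d}(y)>0$. $\Psi_{l,d}(t)$ is the number of packets in the buffer of link $l$ with remaining deadline $d$ in slot $t$, new arrivals included. A packet that is not transmitted loses one unit of remaining deadline per slot and is dropped when it reaches $0$. Let $I_l(t)\in\{0,1\}$ indicate a transmission on link $l$. The deficits $w_l(t)\ge 0$ evolve as $w_l(t+1)=[w_l(t)+\tilde a_l(t)-I_l(t)]^+$, where the deficit arrivals $\tilde a_l(t)$ are an arbitrary random process, with any joint law with the traffic and not affected by the scheduling decisions, and with $0\le\tilde a_l(t)\le a_{\max}$ almost surely for a constant $a_{\max}$ (this includes adding $p_l$ per packet, and coin tossing). **Frame.** Fix $x\in\mathcal X$ and $k\in\mathbb N$. Let $\mathbf x(t_0)=x$,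 and let $t_k$ be the time of the $k$-th return of $\mathbf x$ to $x$ after $t_0$. The frame is $\mathcal F=\{t_0+1,\dots,t_k\}$. The initial state $\mathcal S_{t_0}$ consists of $x$, of the buffer contents carried over into the first slot of the frame (an arbitrary finite number of packets for each link and each remaining deadline in $\{1,\dots,d_{\max}\}$), and of the deficit vector $w(t_0)\in[0,\infty)^{\mathcal K}$ with which the first slot of the frame starts; $\|w(t_0)\|=\sum_l w_l(t_0)$. The gain of a policy over the frame is $\sum_{t\in\mathcal F}\mathcal G(t)$ with $\mathcal G(t)=\sum_l w_l(t)I_l(t)$. **Policies.** A policy chooses in each slot of the frame, possibly at random, either to idle or to send one packet that is present in a buffer. The law of its choice may depend (measurably) on the entire traffic and deficit-arrival path, past and future (so $\mu$ may be non-causal), on the initial state, and on its own past decisions. **AMND.** Let $e_l(t)=\min\{d:\Psi_{l,d}(t)>0\}$ ($=\infty$ if link $l$ is empty). Link $l_1$ strictly dominates $l_2$ if $w_{l_1}\ge w_{l_2}$ and $e_{l_1}\le e_{l_2}$ with at least one strict inequality; a non-dominated link is a non-empty link that no link strictly dominates. Start with $H$ the set of non-empty links; while $H\neq\varnothing$,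 let $h_i$ be a largest-deficit non-dominated link in $H$ (ties broken by any fixed rule that selects an element of each non-empty set of tied links), and remove from $H$ all $l$ with $e_l\ge e_{h_i}$. This yields $h_1,\dots,h_n$. Set $r=1$; for $i=1,\dots,n-1$ let $p_{h_i}=\min(1-w_{h_{i+1}}/w_{h_i},\,r)$ and replace $r$ by $r-p_{h_i}$; finally $p_{h_n}=r$. AMND sends the earliest-deadline packet of $h_i$ with probability $p_{h_i}$, using fresh randomness, independent of the traffic and of the past, in each slot (it idles if all buffers are empty). **Theorem.** Let $\rho=1-(1-1/K)^K$. For every policy $\mu$ and every $\varepsilon>0$ there is $W'$ such that for every initial state $\mathcal S_{t_0}$ with $\|w(t_0)\|\ge W'$ both expected gains below are finite and $$\mathbb E_{\mathcal S_{t_0}}\Big[\sum_{t\in\mathcal F}\mathcal G_{\mathrm{AMND}}(t)\Big]\;\ge\;(\rho-\varepsilon)\,\mathbb E_{\mathcal S_{t_0}}\Big[\sum_{t\in\mathcal F}\mathcal G_{\mu}(t)\Big],$$ where both policies start from $\mathcal S_{t_0}$ and the expectations are over the traffic, the deficit arrivals and the internal randomness of the policies. -/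

import Mathlib

open MeasureTheory
open scoped NNReal ENNReal

namespace RealTimeScheduling

/-! ### Buffers, deficits and one-slot dynamics

`L` is the set of links. Deadlines lie in `1, …, D`; the index `d : Fin D` stands for the
(remaining) deadline `d + 1`. -/

/-- Contents of the buffers (`buf l d` packets of link `l` with remaining deadline `d + 1`) together
with the deficits of the links. -/
@[ext] structure NetState (L : Type*) (D : ℕ) where
  buf : L → Fin D → ℕ
  deficit : L → ℝ≥0

/-- A scheduling decision in a collocated network (the interference graph is complete, so at most
one packet is sent per slot): stay idle, or send a packet of link `l` with remaining deadline
index `d`. -/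
abbrev Decision (L : Type*) (D : ℕ) := Option (L × Fin D)

/-- The indicator `I_{l,d}`: a packet of link `l` with remaining deadline index `d` is sent. -/
def sentPacket {L : Type*} [DecidableEq L] {D : ℕ} (a : Decision L D) (l : L) (d : Fin D) : ℕ :=
  if a = some (l, d) then 1 else 0

/-- The indicator `I_l = ∑_d I_{l,d}`: link `l` transmits. -/
def sent {L : Type*} [DecidableEq L] {D : ℕ} (a : Decision L D) (l : L) : ℕ :=
  ∑ d, sentPacket a l d

/-- Only packets that are present in the buffer can be sent. -/
def Feasible {L : Type*} {D : ℕ} (s : NetState L D) (a : Decision L D) : Prop :=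
  ∀ l d, a = some (l, d) → 0 < s.buf l d

/-- The gain `∑_l w_l I_l` of a decision. -/
noncomputable def gain {L : Type*} [Fintype L] [DecidableEq L] {D : ℕ}
    (s : NetState L D) (a : Decision L D) : ℝ≥0 :=
  ∑ l, s.deficit l * sent a l

/-- New packets `arr` join the buffers. -/
def addArrivals {L : Type*} {D : ℕ} (s : NetState L D) (arr : L → Fin D → ℕ) : NetState L D where
  buf l d := s.buf l d + arr l d
  deficit := s.deficit

/-- End of a slot with deficit arrivals `da` and decision `a`: the sent packet leaves, all remaining
deadlines decrease by one and expired packets are dropped; the deficits become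
`[w_l + da_l - I_l]^+` (subtraction in `ℝ≥0` is truncated at `0`). -/
noncomputable def endOfSlot {L : Type*} [DecidableEq L] {D : ℕ} (s : NetState L D)
    (da : L → ℝ≥0) (a : Decision L D) : NetState L D where
  buf l d :=
    if h : (d : ℕ) + 1 < D then s.buf l ⟨d + 1, h⟩ - sentPacket a l ⟨d + 1, h⟩ else 0
  deficit l := s.deficit l + da l - sent a l

/-! ### Traffic -/

/-- Sample paths of the traffic: at each time the complete traffic state (in `X`) and the vector of
deficit arrivals. Time `0` is the last slot before the frame. -/
abbrev Path (X L : Type*) := ℕ → X × (L → ℝ≥0)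

/-- Under `ν`, the traffic states form a Markov chain with transition matrix `P` started at `x`. -/
def IsMarkovFrom {X L : Type*} [DecidableEq X] [MeasurableSpace X]
    (P : Matrix X X ℝ) (x : X) (ν : Measure (Path X L)) : Prop :=
  ∀ (n : ℕ) (y : ℕ → X), ν {ω | ∀ i ≤ n, (ω i).1 = y i} =
    ENNReal.ofReal (if y 0 = x then ∏ i ∈ Finset.range n, P (y i) (y (i + 1)) else 0)

/-- The time of the `k`-th return of the traffic state to `x`. -/
noncomputable def returnTime {X L : Type*} (x : X) (ω : Path X L) : ℕ → ℕ
  | 0 => 0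
  | k + 1 => sInf {n | returnTime x ω k < n ∧ (ω n).1 = x}

/-! ### Policies

A frame of `k` cycles consists of the slots `1, …, returnTime x ω k`. Histories are lists of past
decisions in the frame, most recent first, so a history `h` belongs to slot `h.length + 1`. -/

/-- State in slot `h.length + 1`, new arrivals included, after the decisions `h`; `s₀` holds the
packets and deficits carried into the first slot of the frame, and `τ y l d` is the number of
packets with deadline index `d` that arrive on link `l` in traffic state `y`. -/
noncomputable def stateAt {X L : Type*} [DecidableEq L] {D : ℕ} (τ : X → L → Fin D → ℕ)
    (ω : Path X L) (s₀ : NetState L D) : List (Decision L D) → NetState L D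
  | [] => addArrivals s₀ (τ (ω 1).1)
  | a :: h => addArrivals (endOfSlot (stateAt τ ω s₀ h) (ω (h.length + 1)).2 a)
      (τ (ω (h.length + 2)).1)

/-- A scheduling policy over a frame, possibly randomized and non-causal: the law of the decision in
a slot may depend on the whole traffic path (past and future), on the state at the start of the
frame, and on the past decisions. Causal policies are special cases. -/
structure Policy {X L : Type*} [DecidableEq L] [MeasurableSpace X] {D : ℕ}
    (τ : X → L → Fin D → ℕ) where
  decide : Path X L → NetState L D → List (Decision L D) → PMF (Decision L D)
  feasible : ∀ ω s₀ h, ∀ a ∈ (decide ω s₀ h).support, Feasible (stateAt τ ω s₀ h) a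
  measurable : ∀ s₀ h a, Measurable fun ω => decide ω s₀ h a

/-- Expected gain, over the internal randomness of the policy, collected in the `n` slots that
follow the history `h`, along the traffic path `ω`. -/
noncomputable def pathGain {X L : Type*} [Fintype L] [DecidableEq L] [MeasurableSpace X] {D : ℕ}
    {τ : X → L → Fin D → ℕ} (π : Policy τ) (ω : Path X L) (s₀ : NetState L D) :
    ℕ → List (Decision L D) → ℝ≥0∞
  | 0, _ => 0
  | n + 1, h => ∑ a, π.decide ω s₀ h a *
      ((gain (stateAt τ ω s₀ h) a : ℝ≥0∞) + pathGain π ω s₀ n (a :: h))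

/-- Expected total gain over a frame of `k` cycles, given the state `s₀` at its start; the
expectation is over the traffic and the internal randomness of the policy. -/
noncomputable def frameGain {X L : Type*} [Fintype L] [DecidableEq L] [MeasurableSpace X] {D : ℕ}
    {τ : X → L → Fin D → ℕ} (ν : Measure (Path X L)) (x : X) (k : ℕ) (π : Policy τ)
    (s₀ : NetState L D) : ℝ≥0∞ :=
  ∫⁻ ω, pathGain π ω s₀ (returnTime x ω k) [] ∂ν

/-! ### Adaptive mixing over non-dominated links -/

section AMND

variable {L : Type*} [Fintype L] [DecidableEq L] {D : ℕ}

/-- Deadline (index) of the earliest-deadline packet of link `l`; `⊤` if the buffer is empty. -/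
def earliest (b : L → Fin D → ℕ) (l : L) : WithTop (Fin D) :=
  (Finset.univ.filter fun d => 0 < b l d).min

/-- Link `l₁` strictly dominates link `l₂`. -/
def StrictlyDominates (e : L → WithTop (Fin D)) (w : L → ℝ≥0) (l₁ l₂ : L) : Prop :=
  (w l₂ ≤ w l₁ ∧ e l₁ ≤ e l₂) ∧ (w l₂ < w l₁ ∨ e l₁ < e l₂)

/-- A nonempty link which no link strictly dominates. -/
def NonDominated (e : L → WithTop (Fin D)) (w : L → ℝ≥0) (l : L) : Prop :=
  e l ≠ ⊤ ∧ ∀ l', ¬ StrictlyDominates e w l' l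

open scoped Classical in
/-- The largest-deficit non-dominated links in `H` (several in case of a tie). -/
noncomputable def topLinks (e : L → WithTop (Fin D)) (w : L → ℝ≥0) (H : Finset L) : Finset L :=
  H.filter fun l => NonDominated e w l ∧ ∀ l' ∈ H, NonDominated e w l' → w l' ≤ w l

/-- A tie-breaking rule: it selects one element of every nonempty set of links. -/
structure TieBreak (L : Type*) where
  pick : Finset L → L
  pick_mem : ∀ S : Finset L, S.Nonempty → pick S ∈ S

theorem pick_mem_of_topLinks (tie : TieBreak L) {e : L → WithTop (Fin D)} {w : L → ℝ≥0}
    {H : Finset L} (h : (topLinks e w H).Nonempty) : tie.pick (topLinks e w H) ∈ H := by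
  classical
  exact (Finset.mem_filter.1 (tie.pick_mem _ h)).1

/-- The loop that lists non-dominated links: take a largest-deficit non-dominated link `i` of `H`,
remove all links `l` of `H` with `e_l ≥ e_i`, and repeat. -/
noncomputable def ndList (tie : TieBreak L) (e : L → WithTop (Fin D)) (w : L → ℝ≥0)
    (H : Finset L) : List L :=
  if _h : (topLinks e w H).Nonempty then
    tie.pick (topLinks e w H) ::
      ndList tie e w (H.filter fun l => e l < e (tie.pick (topLinks e w H)))
  else []
termination_by H.card
decreasing_by
  exact Finset.card_lt_card (Finset.filter_ssubset.2 ⟨_, pick_mem_of_topLinks tie _h, lt_irrefl _⟩)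

/-- The probabilities: along the list `h₁, …, h_k` with remaining mass `r` (initially `1`), link
`h_i` with `i < k` gets `min (1 - w_{h_{i+1}} / w_{h_i}) r`, and `h_k` gets what is left. (The
deficits decrease strictly along the list, so no subtraction is truncated.) -/
noncomputable def mixProb (w : L → ℝ≥0) : ℝ≥0 → List L → L → ℝ≥0
  | _, [] => 0
  | r, [i] => Pi.single i r
  | r, i :: j :: t =>
      Pi.single i (min (1 - w j / w i) r) + mixProb w (r - min (1 - w j / w i) r) (j :: t)

theorem sum_mixProb (w : L → ℝ≥0) (r : ℝ≥0) (t : List L) (ht : t ≠ []) :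
    ∑ l, mixProb w r t l = r := by
  induction t generalizing r with
  | nil => exact absurd rfl ht
  | cons i t ih =>
    cases t with
    | nil => simp [mixProb]
    | cons j t =>
      simp only [mixProb, Pi.add_apply, Finset.sum_add_distrib]
      rw [ih _ (by simp)]
      simp [add_tsub_cancel_of_le]

/-- Sending the earliest-deadline packet of link `l`. -/
def sendEarliest (e : L → WithTop (Fin D)) (l : L) : Decision L D :=
  match e l with
  | ⊤ => none
  | (d : Fin D) => some (l, d)

/-- The random decision: a link of the list `t` drawn with the probabilities `mixProb` sends its
earliest-deadline packet; nothing is sent if the list is empty. -/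
noncomputable def mixLaw (e : L → WithTop (Fin D)) (w : L → ℝ≥0) (t : List L) :
    PMF (Decision L D) :=
  if ht : t = [] then PMF.pure none
  else (PMF.ofFintype (fun l => (mixProb w 1 t l : ℝ≥0∞)) (by
    rw [← ENNReal.ofNNReal_finsetSum, sum_mixProb w 1 t ht, ENNReal.coe_one])).map (sendEarliest e)

/-- The decision of adaptive mixing over non-dominated links for buffers `b` and deficits `w`. -/
noncomputable def amndLaw (tie : TieBreak L) (b : L → Fin D → ℕ) (w : L → ℝ≥0) :
    PMF (Decision L D) :=
  mixLaw (earliest b) w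
    (ndList tie (earliest b) w (Finset.univ.filter fun l => earliest b l ≠ ⊤))

theorem sendEarliest_feasible (s : NetState L D) (l : L) :
    Feasible s (sendEarliest (earliest s.buf) l) := by
  intro l' d h
  unfold sendEarliest at h
  split at h
  · simp at h
  · rename_i d' hd
    simp only [Option.some.injEq, Prod.mk.injEq] at h
    obtain ⟨rfl, rfl⟩ := h
    exact (Finset.mem_filter.1 (Finset.mem_of_min hd)).2

theorem amndLaw_feasible (tie : TieBreak L) (s : NetState L D) (a : Decision L D)
    (ha : a ∈ (amndLaw tie s.buf s.deficit).support) : Feasible s a := by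
  unfold amndLaw mixLaw at ha
  split at ha
  · simp only [PMF.support_pure, Set.mem_singleton_iff] at ha
    subst ha
    intro l d h
    simp at h
  · rw [PMF.support_map] at ha
    obtain ⟨l, -, rfl⟩ := ha
    exact sendEarliest_feasible s l

theorem measurable_topLinks (e : L → WithTop (Fin D)) (H : Finset L) :
    Measurable[_, ⊤] fun w : L → ℝ≥0 => topLinks e w H := by
  let _ : MeasurableSpace (Finset L) := ⊤
  have hle : ∀ l l' : L, Measurable fun w : L → ℝ≥0 => w l ≤ w l' := fun l l' =>
    measurableSet_setOfPred.1 (measurableSet_le (measurable_pi_apply l) (measurable_pi_apply l'))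
  have hlt : ∀ l l' : L, Measurable fun w : L → ℝ≥0 => w l < w l' := fun l l' =>
    measurableSet_setOfPred.1 (measurableSet_lt (measurable_pi_apply l) (measurable_pi_apply l'))
  have hnd : ∀ l : L, Measurable fun w : L → ℝ≥0 => NonDominated e w l := fun l =>
    measurable_const.and (Measurable.forall fun l' =>
      (((hle l l').and measurable_const).and ((hlt l l').or measurable_const)).not)
  have hmem : ∀ l : L, Measurable fun w : L → ℝ≥0 => l ∈ topLinks e w H := by
    intro l
    simp only [topLinks, Finset.mem_filter]
    exact measurable_const.and ((hnd l).and (Measurable.forall fun l' =>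
      measurable_const.imp ((hnd l').imp (hle l' l))))
  refine measurable_to_countable' fun C => ?_
  have : (fun w : L → ℝ≥0 => topLinks e w H) ⁻¹' {C}
      = ⋂ l, {w | l ∈ topLinks e w H ↔ l ∈ C} := by
    ext w
    simp [Finset.ext_iff]
  rw [this]
  exact MeasurableSet.iInter fun l => measurableSet_setOfPred.2 ((hmem l).iff measurable_const)

theorem measurable_ndList (tie : TieBreak L) (e : L → WithTop (Fin D)) (H : Finset L) :
    Measurable[_, ⊤] fun w : L → ℝ≥0 => ndList tie e w H := by
  let _ : MeasurableSpace (Finset L) := ⊤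
  let _ : MeasurableSpace (List L) := ⊤
  induction H using Finset.strongInduction with
  | H H ih =>
    have key : Measurable fun p : Finset L × (L → ℝ≥0) =>
        if p.1.Nonempty ∧ tie.pick p.1 ∈ H then
          tie.pick p.1 :: ndList tie e p.2 (H.filter fun l => e l < e (tie.pick p.1))
        else [] := by
      refine measurable_from_prod_countable_right fun C => ?_
      by_cases hC : C.Nonempty ∧ tie.pick C ∈ H
      · simp only [hC, and_self, if_true]
        exact (measurable_from_top (f := fun t => tie.pick C :: t)).comp
          (ih _ (Finset.filter_ssubset.2 ⟨_, hC.2, lt_irrefl _⟩))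
      · simp only [hC, if_false]
        exact measurable_const
    have h2 := key.comp ((measurable_topLinks e H).prodMk measurable_id)
    convert h2 using 1
    funext w
    simp only [Function.comp, id]
    rw [ndList]
    by_cases hT : (topLinks e w H).Nonempty
    · simp [hT, pick_mem_of_topLinks tie hT]
    · simp [hT]

theorem measurable_mixProb (t : List L) (r : (L → ℝ≥0) → ℝ≥0) (hr : Measurable r) (l : L) :
    Measurable fun w : L → ℝ≥0 => mixProb w (r w) t l := by
  have hs : ∀ (i : L) (f : (L → ℝ≥0) → ℝ≥0), Measurable f →
      Measurable fun w => (Pi.single i (f w) : L → ℝ≥0) l := by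
    intro i f hf
    by_cases h : l = i
    · subst h
      simpa using hf
    · simp [h]
  induction t generalizing r with
  | nil => simp [mixProb]
  | cons i t ih =>
    cases t with
    | nil => exact hs i r hr
    | cons j t =>
      have hp : Measurable fun w : L → ℝ≥0 => min (1 - w j / w i) (r w) :=
        (measurable_const.sub ((measurable_pi_apply j).div (measurable_pi_apply i))).min hr
      exact (hs i _ hp).add (ih _ (hr.sub hp))

theorem measurable_mixLaw (e : L → WithTop (Fin D)) (t : List L) (a : Decision L D) :
    Measurable fun w : L → ℝ≥0 => mixLaw e w t a := by
  by_cases ht : t = []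
  · simp only [mixLaw, ht, dite_true]
    exact measurable_const
  · simp only [mixLaw, ht, dite_false, PMF.map_apply, tsum_fintype, PMF.ofFintype_apply]
    refine Finset.measurable_sum _ fun l _ => ?_
    by_cases h : a = sendEarliest e l
    · simp only [h, if_true]
      exact (measurable_mixProb t (fun _ => 1) measurable_const l).coe_nnreal_ennreal
    · simp [h]

theorem measurable_amndLaw (tie : TieBreak L) (a : Decision L D) :
    Measurable fun p : (L → Fin D → ℕ) × (L → ℝ≥0) => amndLaw tie p.1 p.2 a := by
  let _ : MeasurableSpace (List L) := ⊤
  have : Countable L := Finite.to_countable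
  refine measurable_from_prod_countable_right fun b => ?_
  have key : Measurable fun p : List L × (L → ℝ≥0) => mixLaw (earliest b) p.2 p.1 a :=
    measurable_from_prod_countable_right fun t => measurable_mixLaw _ t a
  exact key.comp ((measurable_ndList tie (earliest b)
    (Finset.univ.filter fun l => earliest b l ≠ ⊤)).prodMk measurable_id)

theorem measurable_stateAt {X : Type*} [MeasurableSpace X] [DiscreteMeasurableSpace X]
    (τ : X → L → Fin D → ℕ) (s₀ : NetState L D) (h : List (Decision L D)) :
    Measurable fun ω : Path X L => ((stateAt τ ω s₀ h).buf, (stateAt τ ω s₀ h).deficit) := by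
  have harr : ∀ n l d, Measurable fun ω : Path X L => τ (ω n).1 l d := fun n l d =>
    (Measurable.of_discrete (f := fun y => τ y l d)).comp
      (measurable_fst.comp (measurable_pi_apply n))
  have main : (∀ l d, Measurable fun ω : Path X L => (stateAt τ ω s₀ h).buf l d) ∧
      ∀ l, Measurable fun ω : Path X L => (stateAt τ ω s₀ h).deficit l := by
    induction h with
    | nil => exact ⟨fun l d => measurable_const.add (harr 1 l d), fun l => measurable_const⟩
    | cons a h ih =>
      refine ⟨fun l d => ?_, fun l => ?_⟩
      · refine Measurable.add ?_ (harr _ l d)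
        by_cases hd : (d : ℕ) + 1 < D
        · simp only [endOfSlot, hd, dite_true]
          exact (ih.1 l _).sub measurable_const
        · simp only [endOfSlot, hd, dite_false]
          exact measurable_const
      · exact ((ih.2 l).add ((measurable_pi_apply l).comp
          (measurable_snd.comp (measurable_pi_apply _)))).sub measurable_const
  exact (measurable_pi_iff.2 fun l => measurable_pi_iff.2 fun d => main.1 l d).prodMk
    (measurable_pi_iff.2 main.2)

theorem measurable_amndLaw_stateAt {X : Type*} [MeasurableSpace X] [DiscreteMeasurableSpace X]
    (tie : TieBreak L) (τ : X → L → Fin D → ℕ) (s₀ : NetState L D) (h : List (Decision L D))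
    (a : Decision L D) :
    Measurable fun ω : Path X L =>
      amndLaw tie (stateAt τ ω s₀ h).buf (stateAt τ ω s₀ h).deficit a := by
  have h₁ := measurable_amndLaw tie a
  have h₂ := measurable_stateAt τ s₀ h
  have h₃ := h₁.comp h₂
  simp only [Function.comp_def] at h₃
  exact h₃

/-- Adaptive mixing over non-dominated links, with ties broken by `tie`, as a policy: it only looks
at the current buffers and deficits. -/
noncomputable def amnd {X : Type*} [MeasurableSpace X] [DiscreteMeasurableSpace X]
    (tie : TieBreak L) (τ : X → L → Fin D → ℕ) : Policy τ where
  decide ω s₀ h := amndLaw tie (stateAt τ ω s₀ h).buf (stateAt τ ω s₀ h).deficit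
  feasible ω s₀ h a ha := amndLaw_feasible tie (stateAt τ ω s₀ h) a ha
  measurable s₀ h a := measurable_amndLaw_stateAt tie τ s₀ h a

end AMND

end RealTimeScheduling

/-! The comparison is made path by path, so foresight gives `μ` no advantage. Fix a path and let
`optVal` be the best total weight attainable when the deficits are frozen. In one slot each deficit
moves by at most `amax + 1`, so re-freezing the weights with `n` slots to go costs at most `n *
(amax + 1)`. Summed over a frame of length `n` the cost is at most `(amax + 1) * n ^ 2`. Up to this
error, every policy gains at most `optVal` (`pathGain_le_optVal`) and AMND gains at least `ρ *
optVal` (`optVal_le_pathGain_amnd`).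

The factor `ρ` comes from a single slot (`amnd_step`). By an exchange argument (`optVal_exchange`)
an optimal first packet is the earliest packet of some link `j` in AMND's list. If AMND sends the
packet of `i` instead, its future optimum falls behind by at most `w i`, and not at all unless `j`
has the earlier deadline (`optVal_switch`). Since `p_i ≤ 1 - w_{i+1} / w_i`, these compensations
telescope: `w j` plus their mean is at most the head weight `w_{h₁}`. So the optimum loses at most
`w_{h₁}` per slot relative to AMND's mean future optimum, while AMND's mean immediate gain is at
least `ρ * w_{h₁}` by the inequality of arithmetic and geometric means (`le_sum_mixProb_mul`).

Return times have geometric tails, hence a finite second moment, and the expected error is a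
constant independent of the initial state (`mul_frameGain_le`). Irreducibility makes an arrival on
any given link occur during the frame with positive probability, so AMND's expected gain grows
linearly with the largest initial deficit (`mul_deficit_le_frameGain`). For large deficits the
constant error is therefore absorbed by `ε`. -/

namespace RealTimeScheduling

/-! ### Optimal gain with frozen weights -/

section Optimum

variable {L : Type*} [DecidableEq L] {D : ℕ}

/-- One slot passes: every remaining deadline decreases by one. -/
def ageBuf (b : L → Fin D → ℕ) : L → Fin D → ℕ :=
  fun l d => if h : (d : ℕ) + 1 < D then b l ⟨d + 1, h⟩ else 0

/-- One slot passes for a single (optional) packet. -/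
def agePacket : Decision L D → Decision L D
  | none => none
  | some (l, d) => if (d : ℕ) = 0 then none else some (l, ⟨d - 1, by omega⟩)

/-- The weight of the sent packet. -/
def packetWeight (w : L → ℝ≥0) : Decision L D → ℝ≥0
  | none => 0
  | some p => w p.1

/-- The remaining deadline of an optional packet; `0` if there is none. -/
def lifetime : Decision L D → ℕ
  | none => 0
  | some p => p.2 + 1

omit [DecidableEq L] in
theorem ageBuf_add (b b' : L → Fin D → ℕ) : ageBuf (b + b') = ageBuf b + ageBuf b' := by
  funext l d
  simp only [ageBuf, Pi.add_apply]
  split <;> simp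

theorem sentPacket_none : sentPacket (none : Decision L D) = 0 := by
  funext l d
  simp [sentPacket]

theorem ageBuf_sentPacket (a : Decision L D) :
    ageBuf (sentPacket a) = sentPacket (agePacket a) := by
  funext l d
  rcases a with _ | ⟨l', d'⟩
  · simp [ageBuf, agePacket, sentPacket]
  · simp only [ageBuf, agePacket, sentPacket]
    have h1 := d.2
    have h2 := d'.2
    by_cases h0 : (d' : ℕ) = 0
    · have : ∀ h : (d : ℕ) + 1 < D, d' ≠ ⟨d + 1, h⟩ := by
        intro h hd
        rw [hd] at h0
        simp at h0
      simp [h0, this]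
    · simp only [h0, if_false, Option.some.injEq, Prod.mk.injEq, Fin.ext_iff]
      by_cases hd : (d : ℕ) + 1 < D
      · have : ((d' : ℕ) = d + 1) ↔ ((d' : ℕ) - 1 = d) := by omega
        simp [hd, this]
      · have : ¬ ((d' : ℕ) - 1 = d) := by omega
        simp [hd, this]

omit [DecidableEq L] in
theorem lifetime_agePacket (a : Decision L D) : lifetime (agePacket a) = lifetime a - 1 := by
  rcases a with _ | ⟨l, d⟩
  · rfl
  · by_cases h : (d : ℕ) = 0
    · simp [agePacket, lifetime, h]
    · simp [agePacket, lifetime, h]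
      omega

omit [DecidableEq L] in
theorem packetWeight_agePacket_le (w : L → ℝ≥0) (a : Decision L D) :
    packetWeight w (agePacket a) ≤ packetWeight w a := by
  rcases a with _ | ⟨l, d⟩
  · exact le_rfl
  · by_cases h : (d : ℕ) = 0 <;> simp [agePacket, packetWeight, h]

omit [DecidableEq L] in
theorem packetWeight_agePacket_le_of_lifetime (w : L → ℝ≥0) {o o' : Decision L D} {c : ℝ≥0}
    (hd : lifetime o ≤ lifetime o') (hw : packetWeight w o ≤ packetWeight w o' + c) :
    packetWeight w (agePacket o) ≤ packetWeight w (agePacket o') + c := by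
  rcases o with _ | ⟨l, d⟩
  · simp [agePacket, packetWeight]
  · rcases o' with _ | ⟨l', d'⟩
    · simp [lifetime] at hd
    · simp only [lifetime] at hd
      by_cases h : (d : ℕ) = 0
      · simp [agePacket, packetWeight, h]
      · have h' : (d' : ℕ) ≠ 0 := by omega
        simpa [agePacket, packetWeight, h, h'] using hw

theorem sentPacket_le_of_ne {b : L → Fin D → ℕ} {a o : Decision L D}
    (h : sentPacket a ≤ b + sentPacket o) (hne : a ≠ o) : sentPacket a ≤ b := by
  intro l d
  have := h l d
  simp only [sentPacket, Pi.add_apply] at this ⊢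
  by_cases h1 : a = some (l, d)
  · have h2 : o ≠ some (l, d) := fun h2 => hne (h1.trans h2.symm)
    simpa [h1, h2] using this
  · simp [h1]

variable [Fintype L]

open scoped Classical in
/-- Largest total weight of the packets that can be sent in `n` slots starting with slot `t`, if the
weight of a packet of link `l` is always `w l`, the buffers in slot `t` are `b` and `arr i` joins
the buffers in slot `i`. -/
noncomputable def optVal (arr : ℕ → L → Fin D → ℕ) (w : L → ℝ≥0) :
    ℕ → ℕ → (L → Fin D → ℕ) → ℝ≥0
  | 0, _, _ => 0
  | n + 1, t, b => (Finset.univ.filter fun a : Decision L D => sentPacket a ≤ b).sup fun a =>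
      packetWeight w a + optVal arr w n (t + 1) (ageBuf (b - sentPacket a) + arr (t + 1))

variable {arr : ℕ → L → Fin D → ℕ} {w : L → ℝ≥0}

theorem optVal_succ_le {n t : ℕ} {b : L → Fin D → ℕ} {c : ℝ≥0}
    (h : ∀ a : Decision L D, sentPacket a ≤ b →
      packetWeight w a + optVal arr w n (t + 1) (ageBuf (b - sentPacket a) + arr (t + 1)) ≤ c) :
    optVal arr w (n + 1) t b ≤ c := by
  classical
  rw [optVal]
  exact Finset.sup_le fun a ha => h a (Finset.mem_filter.1 ha).2

theorem le_optVal_succ (n t : ℕ) {b : L → Fin D → ℕ} (a : Decision L D) (h : sentPacket a ≤ b) :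
    packetWeight w a + optVal arr w n (t + 1) (ageBuf (b - sentPacket a) + arr (t + 1)) ≤
      optVal arr w (n + 1) t b := by
  classical
  rw [optVal]
  exact Finset.le_sup (f := fun a : Decision L D => packetWeight w a +
    optVal arr w n (t + 1) (ageBuf (b - sentPacket a) + arr (t + 1)))
    (Finset.mem_filter.2 ⟨Finset.mem_univ a, h⟩)

theorem optVal_idle_le (n t : ℕ) (b : L → Fin D → ℕ) :
    optVal arr w n (t + 1) (ageBuf b + arr (t + 1)) ≤ optVal arr w (n + 1) t b := by
  have := le_optVal_succ (arr := arr) (w := w) n t (b := b) none (by simp [sentPacket_none])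
  simpa [sentPacket_none, packetWeight] using this

/-- Exchanging one packet of the buffers for another. -/
theorem optVal_exchange (n t : ℕ) (b : L → Fin D → ℕ) (o o' : Decision L D) (c : ℝ≥0)
    (hc : packetWeight w o ≤ c ∨
      (lifetime o ≤ lifetime o' ∧ packetWeight w o ≤ packetWeight w o' + c)) :
    optVal arr w n t (b + sentPacket o) ≤ optVal arr w n t (b + sentPacket o') + c := by
  induction n generalizing t b o o' c with
  | zero => simp [optVal]
  | succ n ih =>
    refine optVal_succ_le fun a ha => ?_
    by_cases hao : a = o
    · subst hao
      rw [add_tsub_cancel_right]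
      rcases hc with hc | ⟨-, hc⟩
      -- Idle in this slot. The leftover `o'` can only help afterwards, which is the induction
      -- hypothesis with `none` and `c = 0`.
      · have h1 := optVal_idle_le (arr := arr) (w := w) n t (b + sentPacket o')
        have h2 := ih (t + 1) (ageBuf b + arr (t + 1)) none (agePacket o') 0
          (Or.inl (by simp [packetWeight]))
        rw [sentPacket_none, add_zero, add_zero] at h2
        rw [ageBuf_add, ageBuf_sentPacket, add_right_comm] at h1
        rw [add_comm]
        exact add_le_add (h2.trans h1) hc
      · have h1 := le_optVal_succ (arr := arr) (w := w) n t (b := b + sentPacket o') o'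
          le_add_self
        rw [add_tsub_cancel_right] at h1
        calc _ ≤ packetWeight w o' + c + optVal arr w n (t + 1) (ageBuf b + arr (t + 1)) := by
              gcongr
          _ = packetWeight w o' + optVal arr w n (t + 1) (ageBuf b + arr (t + 1)) + c := by ring
          _ ≤ _ := by gcongr
    -- The packet sent comes from `b`, so it is available on both sides, and `o`, `o'` simply age.
    · have hab := sentPacket_le_of_ne ha hao
      obtain ⟨b₁, rfl⟩ : ∃ b₁, b = b₁ + sentPacket a :=
        ⟨b - sentPacket a, (tsub_add_cancel_of_le hab).symm⟩
      have h1 := le_optVal_succ (arr := arr) (w := w) n t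
        (b := b₁ + sentPacket a + sentPacket o') a (le_add_right le_add_self)
      rw [add_right_comm, add_tsub_cancel_right, ageBuf_add, ageBuf_sentPacket,
        add_right_comm (ageBuf b₁)] at h1 ⊢
      have h2 := ih (t + 1) (ageBuf b₁ + arr (t + 1)) (agePacket o) (agePacket o') c (by
        rcases hc with hc | ⟨hd, hc⟩
        · exact Or.inl ((packetWeight_agePacket_le w o).trans hc)
        · refine Or.inr ⟨?_, packetWeight_agePacket_le_of_lifetime w hd hc⟩
          rw [lifetime_agePacket, lifetime_agePacket]
          exact Nat.sub_le_sub_right hd 1)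
      calc _ ≤ packetWeight w a + (_ + c) := by gcongr
        _ = packetWeight w a + _ + c := (add_assoc _ _ _).symm
        _ ≤ _ := by
          rw [add_right_comm b₁]
          gcongr

/-- The same schedule is feasible for both weights and sends at most one packet per slot. This pays
for re-freezing the weights at the next slot's deficits. -/
theorem optVal_lipschitz {w' : L → ℝ≥0} {c : ℝ≥0} (hw : ∀ l, w l ≤ w' l + c) (n t : ℕ)
    (b : L → Fin D → ℕ) : optVal arr w n t b ≤ optVal arr w' n t b + n * c := by
  induction n generalizing t b with
  | zero => simp [optVal]
  | succ n ih =>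
    refine optVal_succ_le fun a ha => ?_
    have h1 := le_optVal_succ (arr := arr) (w := w') n t a ha
    have h2 : packetWeight w a ≤ packetWeight w' a + c := by
      rcases a with _ | ⟨l, d⟩
      · simp [packetWeight]
      · exact hw l
    refine (add_le_add h2 (ih _ _)).trans ?_
    rw [add_add_add_comm, Nat.cast_succ, add_one_mul, add_comm c]
    gcongr

theorem optVal_le (n t : ℕ) (b : L → Fin D → ℕ) :
    optVal arr w n t b ≤ n * ∑ l, w l := by
  have h0 : ∀ n t (b : L → Fin D → ℕ), optVal arr (0 : L → ℝ≥0) n t b = 0 := by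
    intro n
    induction n with
    | zero => simp [optVal]
    | succ n ih =>
      intro t b
      refine le_antisymm (optVal_succ_le fun a _ => ?_) zero_le
      rw [ih]
      rcases a with _ | ⟨l, d⟩ <;> simp [packetWeight]
  have := optVal_lipschitz (arr := arr) (w := w) (w' := 0) (c := ∑ l, w l)
    (fun l => by
      rw [Pi.zero_apply, zero_add]
      exact Finset.single_le_sum (f := w) (fun _ _ => zero_le) (Finset.mem_univ l)) n t b
  rwa [h0, zero_add] at this

omit [Fintype L] in
theorem sentPacket_le {b : L → Fin D → ℕ} {l : L} {d : Fin D} (h : 0 < b l d) :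
    sentPacket (some (l, d)) ≤ b := by
  intro l' d'
  simp only [sentPacket, Option.some.injEq, Prod.mk.injEq]
  split_ifs with hh
  · obtain ⟨rfl, rfl⟩ := hh
    exact h
  · exact Nat.zero_le _

theorem le_optVal_of_pos {n t : ℕ} {b : L → Fin D → ℕ} {l : L} {d : Fin D} (h : 0 < b l d)
    (hn : 0 < n) : w l ≤ optVal arr w n t b := by
  obtain ⟨m, rfl⟩ := Nat.exists_eq_succ_of_ne_zero hn.ne'
  exact le_trans le_self_add (le_optVal_succ m t (some (l, d)) (sentPacket_le h))

/-- Idle until slot `t + i`, then send the new packet. The hypothesis `hb` records that the buffers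
of slot `t` already contain its arrivals. -/
theorem le_optVal_of_arrival {n t i : ℕ} {l : L} {d : Fin D} (b : L → Fin D → ℕ)
    (hb : arr t ≤ b) (h : 0 < arr (t + i) l d) (hi : i < n) : w l ≤ optVal arr w n t b := by
  induction i generalizing n t b with
  | zero => exact le_optVal_of_pos (h.trans_le (hb l d)) hi
  | succ i ih =>
    obtain ⟨m, rfl⟩ := Nat.exists_eq_succ_of_ne_zero (Nat.ne_zero_of_lt hi)
    refine le_trans (ih (n := m) (t := t + 1) (ageBuf b + arr (t + 1)) le_add_self ?_ (by omega))
      (optVal_idle_le m t b)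
    rwa [show t + 1 + i = t + (i + 1) by omega]

end Optimum

/-! ### Non-dominated links and mixing probabilities -/

/-- Arithmetic and geometric means of one `x` and `k` copies of `y`. After factoring out `y` it is
Bernoulli's inequality. -/
theorem mul_pow_le_weighted_mean_pow {x y : ℝ} (hx : 0 ≤ x) (hy : 0 ≤ y) {k : ℕ} (hk : k ≠ 0) :
    x * y ^ k ≤ ((x + k * y) / (k + 1)) ^ (k + 1) := by
  rcases hy.eq_or_lt with rfl | hy
  · rw [zero_pow hk, mul_zero]
    positivity
  · have hk1 : (0 : ℝ) < k + 1 := by positivity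
    have hxy : 0 ≤ x / y := by positivity
    have h := one_add_mul_le_pow (a := (x / y - 1) / (k + 1)) (by
      rw [le_div_iff₀ hk1]
      nlinarith) (k + 1)
    have h1 : 1 + ((k + 1 : ℕ) : ℝ) * ((x / y - 1) / (k + 1)) = x / y := by
      push_cast
      field_simp
      ring
    have h2 : (x + k * y) / (k + 1) = y * (1 + (x / y - 1) / (k + 1)) := by
      field_simp
      ring
    rw [h1] at h
    rw [h2, mul_pow]
    calc x * y ^ k = y ^ (k + 1) * (x / y) := by
          rw [pow_succ]
          field_simp
      _ ≤ _ := by gcongr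

theorem one_sub_one_sub_div_pow_le {r : ℝ} (hr1 : r ≤ 1) {m : ℕ} (hm : m ≠ 0) :
    1 - (1 - r / m) ^ m ≤ r := by
  have hm1 : (1 : ℝ) ≤ m := by exact_mod_cast Nat.one_le_iff_ne_zero.2 hm
  have h := one_add_mul_le_pow (a := -(r / m)) (by
    have : r / m ≤ 1 := by
      rw [div_le_one (by linarith)]
      linarith
    linarith) m
  have h1 : (m : ℝ) * (r / m) = r := by field_simp
  have h2 : (1 + -(r / m)) ^ m = (1 - r / m) ^ m := by rw [sub_eq_add_neg]
  rw [h2] at h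
  linarith [h, h1]

section Mixing

variable {L : Type*} [Fintype L] [DecidableEq L] {D : ℕ} {w : L → ℝ≥0}

omit [Fintype L] in
theorem mixProb_eq_zero {l : L} (r : ℝ≥0) {t : List L} (h : l ∉ t) : mixProb w r t l = 0 := by
  induction t generalizing r with
  | nil => simp [mixProb]
  | cons i t ih =>
    rw [List.mem_cons, not_or] at h
    cases t with
    | nil => simp [mixProb, h.1]
    | cons j t => simp [mixProb, h.1, ih _ h.2]

theorem sum_single_mul (i : L) (p : ℝ≥0) (f : L → ℝ≥0) :
    ∑ l, (Pi.single i p : L → ℝ≥0) l * f l = p * f i := by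
  rw [Finset.sum_eq_single i]
  · simp
  · intro l _ hl
    simp [hl]
  · simp

theorem sum_mixProb_mul_cons (r : ℝ≥0) (i j : L) (t : List L) (f : L → ℝ≥0) :
    ∑ l, mixProb w r (i :: j :: t) l * f l = min (1 - w j / w i) r * f i +
      ∑ l, mixProb w (r - min (1 - w j / w i) r) (j :: t) l * f l := by
  simp only [mixProb, Pi.add_apply, add_mul, Finset.sum_add_distrib, sum_single_mul]

/-- The gain of an adversary that sends the packet of link `j` and is compensated by the weights of
the links with later deadlines is at most the largest weight of the list. -/
theorem weight_add_sum_mixProb_le (e : L → WithTop (Fin D)) (r : ℝ≥0) (i j : L) (t : List L)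
    (ht : (i :: t).Pairwise fun i j => w j ≤ w i ∧ e j < e i) (hj : j ∈ i :: t) :
    w j + ∑ l, mixProb w r (i :: t) l * (if e j < e l then w l else 0) ≤ w i := by
  induction t generalizing r i with
  | nil =>
    obtain rfl : j = i := by simpa using hj
    simp only [mixProb]
    rw [sum_single_mul]
    simp
  | cons i' t ih =>
    rw [List.pairwise_cons] at ht
    rcases List.mem_cons.1 hj with rfl | hj
    -- Deadlines strictly decrease along the list, so no entry is later than its head and no
    -- compensation is due.
    · rw [Finset.sum_eq_zero, add_zero]
      intro l _
      by_cases hl : l ∈ j :: i' :: t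
      · have : ¬ e j < e l := by
          rcases List.mem_cons.1 hl with rfl | hl
          · exact lt_irrefl _
          · exact (ht.1 l hl).2.not_gt
        simp [this]
      · simp [mixProb_eq_zero r hl]
    · rw [sum_mixProb_mul_cons]
      set p := min (1 - w i' / w i) r
      have h1 := ih (r - p) i' ht.2 hj
      -- The telescoping step, from `p ≤ 1 - w i' / w i`. It holds for any remaining mass.
      have h2 : p * (if e j < e i then w i else 0) ≤ w i - w i' := by
        calc p * (if e j < e i then w i else 0) ≤ (1 - w i' / w i) * w i := by
              gcongr
              · exact min_le_left _ _
              · split_ifs <;> simp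
          _ = w i - w i' := by
            rcases eq_or_ne (w i) 0 with h0 | h0
            · have := (ht.1 i' (by simp)).1
              simp [h0]
            · rw [tsub_mul, one_mul, div_mul_cancel₀ _ h0]
      calc _ = p * (if e j < e i then w i else 0) +
            (w j + ∑ l, mixProb w (r - p) (i' :: t) l * (if e j < e l then w l else 0)) := by
            ring
        _ ≤ (w i - w i') + w i' := add_le_add h2 h1
        _ = w i := tsub_add_cancel_of_le (ht.1 i' (by simp)).1

/-- The expected weight of the link drawn with the mixing probabilities. -/
theorem le_sum_mixProb_mul (r : ℝ≥0) (hr : r ≤ 1) (i : L) (t : List L)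
    (ht : (i :: t).Pairwise fun i j => w j ≤ w i) (m : ℕ) (hm : t.length + 1 ≤ m) :
    (1 - (1 - (r : ℝ) / m) ^ m) * w i ≤ ((∑ l, mixProb w r (i :: t) l * w l : ℝ≥0) : ℝ) := by
  induction t generalizing r i m with
  | nil =>
    simp only [mixProb, sum_single_mul, NNReal.coe_mul]
    gcongr
    exact one_sub_one_sub_div_pow_le (by exact_mod_cast hr) (by omega)
  | cons j t ih =>
    rw [List.pairwise_cons] at ht
    have hji : w j ≤ w i := ht.1 j (by simp)
    rw [sum_mixProb_mul_cons]
    -- Either the head takes all the remaining mass, and Bernoulli's inequality suffices, or it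
    -- takes `1 - x` with `x = w j / w i` and the induction hypothesis bounds the tail.
    rcases le_total r (1 - w j / w i) with h | h
    · rw [min_eq_right h]
      push_cast
      refine le_trans ?_ (le_add_of_nonneg_right (by positivity))
      gcongr
      exact one_sub_one_sub_div_pow_le (by exact_mod_cast hr) (by omega)
    · rw [min_eq_left h]
      rcases eq_or_ne (w i) 0 with h0 | h0
      · simp only [h0, NNReal.coe_zero, mul_zero]
        positivity
      have hx1 : w j / w i ≤ 1 := div_le_one_of_le₀ hji zero_le
      simp only [List.length_cons] at hm
      obtain ⟨k, rfl⟩ : ∃ k, m = k + 1 := ⟨m - 1, by omega⟩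
      have h1 := ih (r - (1 - w j / w i)) (tsub_le_self.trans hr) j ht.2 k (by omega)
      have hwi : (0 : ℝ) < w i := by positivity
      obtain ⟨x, hx⟩ : ∃ x : ℝ≥0, x = w j / w i := ⟨_, rfl⟩
      have hwj : (w j : ℝ) = x * w i := by
        rw [hx]
        push_cast
        field_simp
      rw [← hx] at h h1 hx1 ⊢
      have hk : k ≠ 0 := by omega
      have hk1 : (1 : ℝ) ≤ k := by exact_mod_cast Nat.one_le_iff_ne_zero.2 hk
      have hrR : (r : ℝ) ≤ 1 := by exact_mod_cast hr
      have hxR : (x : ℝ) ≤ 1 := by exact_mod_cast hx1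
      rw [NNReal.coe_sub h, NNReal.coe_sub hx1, NNReal.coe_one, hwj] at h1
      rw [NNReal.coe_add, NNReal.coe_mul, NNReal.coe_sub hx1, NNReal.coe_one]
      refine le_trans ?_ (add_le_add_right h1 _)
      have hy : 0 ≤ 1 - ((r : ℝ) - (1 - x)) / k := by
        rw [sub_nonneg, div_le_one (by linarith)]
        linarith
      -- Head and tail together give `w i * (1 - x * y ^ k)` with `y = 1 - (r - (1 - x)) / k`. The
      -- mean of `x` and `k` copies of `y` is `1 - r / (k + 1)`, whatever `x` is.
      have h2 := mul_pow_le_weighted_mean_pow x.2 hy hk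
      have h3 : ((x : ℝ) + k * (1 - ((r : ℝ) - (1 - x)) / k)) / (k + 1) =
          1 - r / ((k + 1 : ℕ) : ℝ) := by
        push_cast
        field_simp
        ring
      have h4 : (x : ℝ) * (1 - ((r : ℝ) - (1 - x)) / k) ^ k ≤
          (1 - r / ((k + 1 : ℕ) : ℝ)) ^ (k + 1) := h3 ▸ h2
      nlinarith [mul_le_mul_of_nonneg_right h4 hwi.le]

end Mixing

/-! ### Structure of the list of non-dominated links -/

section NonDominated

variable {L : Type*} [Fintype L] [DecidableEq L] {D : ℕ} {e : L → WithTop (Fin D)} {w : L → ℝ≥0}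

omit [DecidableEq L] in
-- Among the finitely many links at least as heavy and as early as `l`, take a maximal one; a strict
-- dominator would contradict maximality.
theorem exists_nonDominated {l : L} (hl : e l ≠ ⊤) :
    ∃ l', NonDominated e w l' ∧ w l ≤ w l' ∧ e l' ≤ e l := by
  obtain ⟨i, hi, hmax⟩ := Set.Finite.exists_maximalFor
    (fun l => (w l, OrderDual.toDual (e l))) {l' | w l ≤ w l' ∧ e l' ≤ e l} (Set.toFinite _)
    ⟨l, le_rfl, le_rfl⟩
  refine ⟨i, ⟨ne_top_of_le_ne_top hl hi.2, ?_⟩, hi⟩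
  rintro j ⟨⟨h1, h2⟩, h3⟩
  have := @hmax j ⟨hi.1.trans h1, h2.trans hi.2⟩ ⟨h1, h2⟩
  rcases h3 with h3 | h3
  · exact h3.not_ge this.1
  · exact h3.not_ge this.2

theorem mem_topLinks {H : Finset L} {l : L} : l ∈ topLinks e w H ↔
    l ∈ H ∧ NonDominated e w l ∧ ∀ l' ∈ H, NonDominated e w l' → w l' ≤ w l := by
  classical
  exact Finset.mem_filter

variable (tie : TieBreak L)

theorem filter_lt_pick_ssubset {H : Finset L} (hT : (topLinks e w H).Nonempty) :
    (H.filter fun l => e l < e (tie.pick (topLinks e w H))) ⊂ H :=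
  Finset.filter_ssubset.2 ⟨_, pick_mem_of_topLinks tie hT, lt_irrefl _⟩

theorem mem_ndList {H : Finset L} {l : L} (h : l ∈ ndList tie e w H) :
    l ∈ H ∧ NonDominated e w l := by
  induction H using Finset.strongInduction with
  | H H ih =>
    rw [ndList] at h
    split_ifs at h with hT
    · rcases List.mem_cons.1 h with rfl | h
      · have := mem_topLinks.1 (tie.pick_mem _ hT)
        exact ⟨this.1, this.2.1⟩
      · have := ih _ (filter_lt_pick_ssubset tie hT) h
        exact ⟨(Finset.mem_filter.1 this.1).1, this.2⟩
    · simp at h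

theorem pairwise_ndList (H : Finset L) :
    (ndList tie e w H).Pairwise fun i j => w j ≤ w i ∧ e j < e i := by
  induction H using Finset.strongInduction with
  | H H ih =>
    rw [ndList]
    split_ifs with hT
    · rw [List.pairwise_cons]
      refine ⟨fun l hl => ?_,
        ih _ (filter_lt_pick_ssubset tie hT)⟩
      obtain ⟨h1, h2⟩ := mem_ndList tie hl
      rw [Finset.mem_filter] at h1
      exact ⟨(mem_topLinks.1 (tie.pick_mem _ hT)).2.2 l h1.1 h2, h1.2⟩
    · exact List.Pairwise.nil

/-- A round that removes `l` has picked a link with no later deadline and, being a largest-deficit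
choice, no smaller weight; otherwise `l` survives to the next round. -/
theorem exists_mem_ndList {H : Finset L} {l : L} (hl : l ∈ H) (hnd : NonDominated e w l) :
    ∃ i ∈ ndList tie e w H, w l ≤ w i ∧ e i ≤ e l := by
  classical
  induction H using Finset.strongInduction with
  | H H ih =>
    have hT : (topLinks e w H).Nonempty := by
      obtain ⟨i, hi, hmax⟩ := (H.filter fun l => NonDominated e w l).exists_max_image w
        ⟨l, Finset.mem_filter.2 ⟨hl, hnd⟩⟩
      rw [Finset.mem_filter] at hi
      exact ⟨i, mem_topLinks.2 ⟨hi.1, hi.2, fun l' h1 h2 => hmax l' (Finset.mem_filter.2 ⟨h1, h2⟩)⟩⟩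
    have htop := mem_topLinks.1 (tie.pick_mem _ hT)
    rw [ndList, dif_pos hT]
    by_cases h : e l < e (tie.pick (topLinks e w H))
    · obtain ⟨i, hi, hi'⟩ := ih _ (filter_lt_pick_ssubset tie hT)
        (Finset.mem_filter.2 ⟨hl, h⟩)
      exact ⟨i, List.mem_cons_of_mem _ hi, hi'⟩
    · exact ⟨_, List.mem_cons_self, htop.2.2 l hl hnd, not_lt.1 h⟩

/-- The list of non-dominated links used by AMND. -/
noncomputable def activeLinks (tie : TieBreak L) (b : L → Fin D → ℕ) (w : L → ℝ≥0) : List L :=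
  ndList tie (earliest b) w (Finset.univ.filter fun l => earliest b l ≠ ⊤)

theorem exists_mem_activeLinks {b : L → Fin D → ℕ} {l : L} {d : Fin D} (h : 0 < b l d) :
    ∃ i ∈ activeLinks tie b w, w l ≤ w i ∧ earliest b i ≤ d := by
  have hle : earliest b l ≤ d := Finset.min_le (by simpa using h)
  have hne : earliest b l ≠ ⊤ := ne_top_of_le_ne_top WithTop.coe_ne_top hle
  obtain ⟨l', hnd, h1, h2⟩ := exists_nonDominated (w := w) hne
  have hl' : l' ∈ Finset.univ.filter fun l => earliest b l ≠ ⊤ :=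
    Finset.mem_filter.2 ⟨Finset.mem_univ l', hnd.1⟩
  obtain ⟨i, hi, h3, h4⟩ := exists_mem_ndList tie hl' hnd
  exact ⟨i, hi, h1.trans h3, h4.trans (h2.trans hle)⟩

theorem exists_of_mem_activeLinks {b : L → Fin D → ℕ} {i : L} (h : i ∈ activeLinks tie b w) :
    ∃ d : Fin D, earliest b i = d ∧ sendEarliest (earliest b) i = some (i, d) ∧ 0 < b i d := by
  obtain ⟨d, hd⟩ := WithTop.ne_top_iff_exists.1 (mem_ndList tie h).2.1
  refine ⟨d, hd.symm, ?_, ?_⟩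
  · unfold sendEarliest
    rw [← hd]
  · exact (Finset.mem_filter.1 (Finset.mem_of_min hd.symm)).2

theorem nodup_activeLinks (b : L → Fin D → ℕ) : (activeLinks tie b w).Nodup :=
  (pairwise_ndList tie _).imp fun h => by
    rintro rfl
    exact lt_irrefl _ h.2

end NonDominated

/-! ### One slot of AMND against the optimum -/

section Step

variable {L : Type*} [Fintype L] [DecidableEq L] {D : ℕ} {arr : ℕ → L → Fin D → ℕ} {w : L → ℝ≥0}
  (tie : TieBreak L)

/-- Sending the earliest packet of some active link is optimal. -/
theorem exists_active_optVal_le {b : L → Fin D → ℕ} (n t : ℕ) (hne : activeLinks tie b w ≠ []) :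
    ∃ j ∈ activeLinks tie b w, optVal arr w (n + 1) t b ≤ w j + optVal arr w n (t + 1)
      (ageBuf (b - sentPacket (sendEarliest (earliest b) j)) + arr (t + 1)) := by
  suffices h : ∀ a : Decision L D, sentPacket a ≤ b → ∃ j ∈ activeLinks tie b w,
      packetWeight w a + optVal arr w n (t + 1) (ageBuf (b - sentPacket a) + arr (t + 1)) ≤
      w j + optVal arr w n (t + 1)
        (ageBuf (b - sentPacket (sendEarliest (earliest b) j)) + arr (t + 1)) by
    classical
    obtain ⟨a, ha, hmax⟩ := Finset.exists_max_image
      (Finset.univ.filter fun a : Decision L D => sentPacket a ≤ b)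
      (fun a => packetWeight w a + optVal arr w n (t + 1) (ageBuf (b - sentPacket a) + arr (t + 1)))
      ⟨none, by simp [sentPacket_none]⟩
    obtain ⟨j, hj, hle⟩ := h a (Finset.mem_filter.1 ha).2
    exact ⟨j, hj, optVal_succ_le fun a' ha' => (hmax a' (by simpa using ha')).trans hle⟩
  intro a ha
  -- Any packet `a` is matched by an active link whose earliest packet is at least as heavy and
  -- expires no later.
  have key : ∃ j ∈ activeLinks tie b w, ∀ d : Fin D, earliest b j = d →
      packetWeight w a ≤ w j ∧ (a = none ∨ (d : ℕ) + 1 ≤ lifetime a) := by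
    rcases a with _ | ⟨l, d⟩
    · obtain ⟨j, hj⟩ := List.exists_mem_of_ne_nil _ hne
      exact ⟨j, hj, fun d _ => ⟨by simp [packetWeight], Or.inl rfl⟩⟩
    · have hpos : 0 < b l d := by
        have := ha l d
        simp only [sentPacket, if_true] at this
        omega
      obtain ⟨j, hj, h1, h2⟩ := exists_mem_activeLinks (w := w) tie hpos
      refine ⟨j, hj, fun d' hd' => ⟨h1, Or.inr ?_⟩⟩
      rw [hd', WithTop.coe_le_coe] at h2
      exact Nat.succ_le_succ h2
  obtain ⟨j, hj, hkey⟩ := key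
  refine ⟨j, hj, ?_⟩
  obtain ⟨d, hd, hsend, hpos⟩ := exists_of_mem_activeLinks tie hj
  obtain ⟨hw, hlife⟩ := hkey d hd
  rw [hsend]
  by_cases hag : a = some (j, d)
  · rw [hag]
    exact le_rfl
  set g : Decision L D := some (j, d)
  have hg : packetWeight w g = w j := rfl
  have hgb : sentPacket g ≤ b := sentPacket_le hpos
  obtain ⟨b₀, rfl⟩ : ∃ b₀, b = b₀ + sentPacket a + sentPacket g := by
    refine ⟨b - sentPacket g - sentPacket a, ?_⟩
    rw [tsub_add_cancel_of_le, tsub_add_cancel_of_le hgb]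
    refine sentPacket_le_of_ne (o := g) ?_ hag
    rwa [tsub_add_cancel_of_le hgb]
  rw [add_right_comm b₀, add_tsub_cancel_right, ← add_right_comm b₀, add_tsub_cancel_right,
    ageBuf_add, ageBuf_add, ageBuf_sentPacket, ageBuf_sentPacket, add_right_comm,
    add_right_comm (ageBuf b₀) (sentPacket (agePacket a))]
  -- Sending the active packet `g` instead of `a` gains `w j - packetWeight w a` now. Keeping `a`
  -- rather than `g`, which expires no later, loses at most that amount afterwards.
  have hex := optVal_exchange (arr := arr) (w := w) n (t + 1) (ageBuf b₀ + arr (t + 1))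
    (agePacket g) (agePacket a) (w j - packetWeight w a) (by
      rcases hlife with rfl | hlife
      · left
        simpa [packetWeight] using packetWeight_agePacket_le w g
      · right
        refine ⟨?_, ?_⟩
        · rw [lifetime_agePacket, lifetime_agePacket]
          exact Nat.sub_le_sub_right hlife 1
        · refine packetWeight_agePacket_le_of_lifetime w hlife ?_
          rw [hg, add_tsub_cancel_of_le hw])
  refine (add_le_add_right hex _).trans ?_
  rw [add_left_comm, add_tsub_cancel_of_le hw, add_comm]

/-- Sending the earliest packet of an active link `i` instead of that of `j` loses at most the
weight of `i`, and nothing if `i` has the earlier deadline. -/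
theorem optVal_switch {b : L → Fin D → ℕ} (n t : ℕ) {i j : L} (hi : i ∈ activeLinks tie b w)
    (hj : j ∈ activeLinks tie b w) :
    optVal arr w n t (ageBuf (b - sentPacket (sendEarliest (earliest b) j)) + arr t) ≤
      (if earliest b j < earliest b i then w i else 0) +
      optVal arr w n t (ageBuf (b - sentPacket (sendEarliest (earliest b) i)) + arr t) := by
  by_cases hij : i = j
  · subst hij
    exact le_add_self
  obtain ⟨d, hd, hsend, hpos⟩ := exists_of_mem_activeLinks tie hi
  obtain ⟨d', hd', hsend', hpos'⟩ := exists_of_mem_activeLinks tie hj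
  -- Otherwise `i` would strictly dominate `j`.
  have hlight : ¬ earliest b j < earliest b i → w i ≤ w j := by
    intro h
    by_contra hlt
    have hnd := (mem_ndList tie hj).2.2 i
    exact hnd ⟨⟨(not_le.1 hlt).le, not_lt.1 h⟩, Or.inl (not_le.1 hlt)⟩
  rw [hsend, hsend']
  set f : Decision L D := some (i, d)
  set g : Decision L D := some (j, d')
  have hfg : f ≠ g := fun h => hij (congrArg Prod.fst (Option.some.inj h))
  have hgb : sentPacket g ≤ b := sentPacket_le hpos'
  obtain ⟨b₀, hb₀⟩ : ∃ b₀, b = b₀ + sentPacket f + sentPacket g := by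
    refine ⟨b - sentPacket g - sentPacket f, ?_⟩
    rw [tsub_add_cancel_of_le, tsub_add_cancel_of_le hgb]
    refine sentPacket_le_of_ne (o := g) ?_ hfg
    rw [tsub_add_cancel_of_le hgb]
    exact sentPacket_le hpos
  have hbg : b - sentPacket g = b₀ + sentPacket f := by rw [hb₀, add_tsub_cancel_right]
  have hbf : b - sentPacket f = b₀ + sentPacket g := by
    rw [hb₀, add_right_comm, add_tsub_cancel_right]
  rw [hbg, hbf, ageBuf_add, ageBuf_add, ageBuf_sentPacket, ageBuf_sentPacket, add_right_comm,
    add_right_comm (ageBuf b₀) (sentPacket (agePacket g)), add_comm (ite _ _ _)]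
  refine optVal_exchange _ _ _ _ _ _ ?_
  split_ifs with h
  · exact Or.inl (packetWeight_agePacket_le w f)
  · right
    have hdd : lifetime f ≤ lifetime g := by
      rw [hd, hd', WithTop.coe_lt_coe, not_lt] at h
      exact Nat.succ_le_succ h
    refine ⟨?_, packetWeight_agePacket_le_of_lifetime w hdd ?_⟩
    · rw [lifetime_agePacket, lifetime_agePacket]
      exact Nat.sub_le_sub_right hdd 1
    · rw [add_zero]
      exact hlight h

/-- In one slot, AMND gains at least the fraction `ρ` of the (amortized) gain of the optimum. -/
theorem amnd_step {ρ : ℝ≥0}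
    (hρ : (ρ : ℝ) ≤ 1 - (1 - 1 / (Fintype.card L : ℝ)) ^ Fintype.card L)
    {b : L → Fin D → ℕ} (n t : ℕ) (hne : activeLinks tie b w ≠ []) :
    ρ * optVal arr w (n + 1) t b ≤ ∑ l, mixProb w 1 (activeLinks tie b w) l *
      (w l + ρ * optVal arr w n (t + 1)
        (ageBuf (b - sentPacket (sendEarliest (earliest b) l)) + arr (t + 1))) := by
  obtain ⟨j, hj, hopt⟩ := exists_active_optVal_le (arr := arr) tie n t hne
  set T := activeLinks tie b w with hT
  set V : L → ℝ≥0 := fun l => optVal arr w n (t + 1)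
    (ageBuf (b - sentPacket (sendEarliest (earliest b) l)) + arr (t + 1)) with hV
  obtain ⟨i, t', hit⟩ := List.exists_cons_of_ne_nil hne
  have hpw : T.Pairwise fun i j => w j ≤ w i ∧ earliest b j < earliest b i := pairwise_ndList tie _
  have hlen : T.length ≤ Fintype.card L := (nodup_activeLinks tie b).length_le_card
  -- Average the switch from `j` to the drawn link `l`; here `i` is the head of the list.
  have h1 : optVal arr w (n + 1) t b ≤ w i + ∑ l, mixProb w 1 T l * V l := by
    calc optVal arr w (n + 1) t b = ∑ l, mixProb w 1 T l * optVal arr w (n + 1) t b := by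
          rw [← Finset.sum_mul, sum_mixProb w 1 T hne, one_mul]
      _ ≤ ∑ l, mixProb w 1 T l *
          (w j + ((if earliest b j < earliest b l then w l else 0) + V l)) := by
          refine Finset.sum_le_sum fun l _ => ?_
          by_cases hl : l ∈ T
          · gcongr
            exact hopt.trans (add_le_add_right (optVal_switch tie n (t + 1) hl hj) _)
          · simp [mixProb_eq_zero 1 hl]
      _ = w j + ∑ l, mixProb w 1 T l * (if earliest b j < earliest b l then w l else 0) +
          ∑ l, mixProb w 1 T l * V l := by
          simp only [mul_add, Finset.sum_add_distrib, ← Finset.sum_mul, sum_mixProb w 1 T hne,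
            one_mul, add_assoc]
      _ ≤ _ := by
          gcongr
          have := weight_add_sum_mixProb_le (w := w) (earliest b) 1 i j t' (hit ▸ hpw)
            (hit ▸ hj)
          rwa [← hit] at this
  have h2 : ρ * w i ≤ ∑ l, mixProb w 1 T l * w l := by
    have := le_sum_mixProb_mul (w := w) 1 le_rfl i t' ((hit ▸ hpw).imp And.left) (Fintype.card L)
      (by rw [hit] at hlen; simpa using hlen)
    rw [← NNReal.coe_le_coe, hit]
    refine le_trans ?_ this
    rw [NNReal.coe_mul, NNReal.coe_one]
    gcongr
  calc ρ * optVal arr w (n + 1) t b ≤ ρ * (w i + ∑ l, mixProb w 1 T l * V l) := by gcongr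
    _ = ρ * w i + ∑ l, mixProb w 1 T l * (ρ * V l) := by
      rw [mul_add, Finset.mul_sum]
      congr 1
      exact Finset.sum_congr rfl fun l _ => by ring
    _ ≤ ∑ l, mixProb w 1 T l * w l + ∑ l, mixProb w 1 T l * (ρ * V l) := by gcongr
    _ = _ := by simp only [hV, mul_add, Finset.sum_add_distrib]

end Step

/-! ### Gains along a traffic path -/

/-- Error accounting for the backward inductions: `n * c` for re-freezing now, `c * n ^ 2` for the
later slots. -/
theorem mul_add_mul_sq_le (n : ℕ) (c : ℝ≥0) :
    n * c + c * (n : ℝ≥0) ^ 2 ≤ c * ((n + 1 : ℕ) : ℝ≥0) ^ 2 := by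
  push_cast
  calc n * c + c * (n : ℝ≥0) ^ 2 ≤ n * c + c * (n : ℝ≥0) ^ 2 + (n * c + c) := le_self_add
    _ = _ := by ring

section PathGain

variable {X L : Type*} [Fintype L] [DecidableEq L] {D : ℕ}

omit [Fintype L] in
theorem sent_some (l l' : L) (d : Fin D) :
    sent (some (l, d) : Decision L D) l' = if l = l' then 1 else 0 := by
  by_cases h : l = l'
  · subst h
    simp [sent, sentPacket]
  · simp [sent, sentPacket, h]

theorem gain_eq_packetWeight (s : NetState L D) (a : Decision L D) :
    gain s a = packetWeight s.deficit a := by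
  rcases a with _ | ⟨l, d⟩
  · simp [gain, sent, sentPacket, packetWeight]
  · simp [gain, sent_some, packetWeight]

omit [Fintype L] in
theorem sent_le_one (a : Decision L D) (l : L) : sent a l ≤ 1 := by
  rcases a with _ | ⟨l', d⟩
  · simp [sent, sentPacket]
  · rw [sent_some]
    split_ifs <;> simp

omit [Fintype L] in
theorem feasible_iff (s : NetState L D) (a : Decision L D) :
    Feasible s a ↔ sentPacket a ≤ s.buf := by
  constructor
  · intro h l d
    simp only [sentPacket]
    split_ifs with ha
    · exact h l d ha
    · exact Nat.zero_le _
  · rintro h l d rfl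
    have := h l d
    simp only [sentPacket, if_true] at this
    exact this

variable (τ : X → L → Fin D → ℕ) (ω : Path X L) (s₀ : NetState L D)

omit [Fintype L] in
theorem stateAt_cons_deficit (h : List (Decision L D)) (a : Decision L D) (l : L) :
    (stateAt τ ω s₀ (a :: h)).deficit l =
      (stateAt τ ω s₀ h).deficit l + (ω (h.length + 1)).2 l - sent a l := rfl

variable {amax : ℝ≥0}

omit [Fintype L] in
theorem deficit_cons_le (hω : ∀ n l, (ω n).2 l ≤ amax) (h : List (Decision L D))
    (a : Decision L D) (l : L) :
    (stateAt τ ω s₀ (a :: h)).deficit l ≤ (stateAt τ ω s₀ h).deficit l + (amax + 1) := by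
  rw [stateAt_cons_deficit]
  refine tsub_le_self.trans ?_
  gcongr
  exact (hω _ l).trans le_self_add

omit [Fintype L] in
theorem deficit_le_cons (h : List (Decision L D)) (a : Decision L D) (l : L) :
    (stateAt τ ω s₀ h).deficit l ≤ (stateAt τ ω s₀ (a :: h)).deficit l + (amax + 1) := by
  rw [stateAt_cons_deficit]
  have h1 : (sent a l : ℝ≥0) ≤ 1 := by exact_mod_cast sent_le_one a l
  calc (stateAt τ ω s₀ h).deficit l ≤ (stateAt τ ω s₀ h).deficit l + (ω (h.length + 1)).2 l :=
        le_self_add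
    _ ≤ _ := le_tsub_add
    _ ≤ _ := by
      gcongr
      exact h1.trans le_add_self

variable [MeasurableSpace X] {τ}

/-- Backward induction: the bound holds after each feasible decision, hence for any mixture of them,
however the mixture depends on the path. -/
theorem pathGain_le_optVal (hω : ∀ n l, (ω n).2 l ≤ amax) (π : Policy τ) (n : ℕ)
    (h : List (Decision L D)) :
    pathGain π ω s₀ n h ≤ ((optVal (fun i => τ (ω i).1) (stateAt τ ω s₀ h).deficit n (h.length + 1)
      (stateAt τ ω s₀ h).buf + (amax + 1) * n ^ 2 : ℝ≥0) : ℝ≥0∞) := by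
  induction n generalizing h with
  | zero => simp [pathGain]
  | succ n ih =>
    rw [pathGain]
    set B : ℝ≥0 := optVal (fun i => τ (ω i).1) (stateAt τ ω s₀ h).deficit (n + 1) (h.length + 1)
      (stateAt τ ω s₀ h).buf + (amax + 1) * ((n + 1 : ℕ) : ℝ≥0) ^ 2 with hB
    have hsum : ∑ a, π.decide ω s₀ h a = 1 := by
      rw [← tsum_fintype (L := .unconditional _)]
      exact PMF.tsum_coe _
    calc _ ≤ ∑ a, π.decide ω s₀ h a * (B : ℝ≥0∞) := by
          refine Finset.sum_le_sum fun a _ => ?_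
          by_cases ha : a ∈ (π.decide ω s₀ h).support
          · gcongr
            refine (add_le_add_right (ih (a :: h)) _).trans ?_
            have hf := (feasible_iff _ _).1 (π.feasible ω s₀ h a ha)
            have h1 := le_optVal_succ (arr := fun i => τ (ω i).1)
              (w := (stateAt τ ω s₀ h).deficit) n (h.length + 1) a hf
            have h2 := optVal_lipschitz (arr := fun i => τ (ω i).1)
              (deficit_cons_le τ ω s₀ hω h a) n (h.length + 2) (stateAt τ ω s₀ (a :: h)).buf
            rw [← ENNReal.coe_add, ENNReal.coe_le_coe, gain_eq_packetWeight, List.length_cons]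
            refine (add_le_add_right (add_le_add_left h2 _) _).trans ?_
            rw [hB, add_assoc (optVal _ _ _ _ _), ← add_assoc]
            exact add_le_add h1 (mul_add_mul_sq_le n _)
          · rw [PMF.mem_support_iff, not_not] at ha
            simp [ha]
      _ = B := by rw [← Finset.sum_mul, hsum, one_mul]

variable (tie : TieBreak L)

theorem amndLaw_of_activeLinks_eq_nil {b : L → Fin D → ℕ} {w : L → ℝ≥0}
    (h : activeLinks tie b w = []) : amndLaw tie b w = PMF.pure none := by
  rw [activeLinks] at h
  rw [amndLaw, mixLaw, dif_pos h]

theorem sum_amndLaw_mul {b : L → Fin D → ℕ} {w : L → ℝ≥0} (h : activeLinks tie b w ≠ [])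
    (f : Decision L D → ℝ≥0∞) :
    ∑ a, amndLaw tie b w a * f a =
      ∑ l, (mixProb w 1 (activeLinks tie b w) l : ℝ≥0∞) * f (sendEarliest (earliest b) l) := by
  have h' := h
  rw [activeLinks] at h'
  rw [amndLaw, mixLaw, dif_neg h']
  simp only [PMF.map_apply, tsum_fintype, PMF.ofFintype_apply, Finset.sum_mul, activeLinks]
  rw [Finset.sum_comm]
  refine Finset.sum_congr rfl fun l _ => ?_
  rw [Finset.sum_eq_single (sendEarliest (earliest b) l)]
  · simp
  · intro a _ ha
    simp [ha]
  · simp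

variable [DiscreteMeasurableSpace X]

theorem optVal_le_pathGain_amnd {ρ : ℝ≥0}
    (hρ : (ρ : ℝ) ≤ 1 - (1 - 1 / (Fintype.card L : ℝ)) ^ Fintype.card L) (hρ1 : ρ ≤ 1)
    (n : ℕ) (h : List (Decision L D)) :
    ((ρ * optVal (fun i => τ (ω i).1) (stateAt τ ω s₀ h).deficit n (h.length + 1)
      (stateAt τ ω s₀ h).buf : ℝ≥0) : ℝ≥0∞) ≤
      pathGain (amnd tie τ) ω s₀ n h + (((amax + 1) * n ^ 2 : ℝ≥0) : ℝ≥0∞) := by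
  induction n generalizing h with
  | zero => simp [optVal]
  | succ n ih =>
    rw [pathGain]
    set arr : ℕ → L → Fin D → ℕ := fun i => τ (ω i).1 with harr
    set b := (stateAt τ ω s₀ h).buf with hb
    set w := (stateAt τ ω s₀ h).deficit with hw
    set C : ℝ≥0 := (amax + 1) * ((n + 1 : ℕ) : ℝ≥0) ^ 2 with hC
    -- Re-freezing at the deficits after `a`. Since `ρ ≤ 1`, its cost need not be scaled by `ρ`.
    have hstep : ∀ a : Decision L D,
        ((ρ * optVal arr w n (h.length + 2) (ageBuf (b - sentPacket a) + arr (h.length + 2))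
          : ℝ≥0) : ℝ≥0∞) ≤ pathGain (amnd tie τ) ω s₀ n (a :: h) + (C : ℝ≥0∞) := by
      intro a
      have h2 := optVal_lipschitz (arr := arr) (deficit_le_cons (amax := amax) τ ω s₀ h a) n
        (h.length + 2) (stateAt τ ω s₀ (a :: h)).buf
      have h3 : ρ * optVal arr w n (h.length + 2)
          (ageBuf (b - sentPacket a) + arr (h.length + 2)) ≤
          ρ * optVal arr (stateAt τ ω s₀ (a :: h)).deficit n (h.length + 2)
            (stateAt τ ω s₀ (a :: h)).buf + n * (amax + 1) := by
        calc _ ≤ ρ * (_ + n * (amax + 1)) := mul_le_mul_right h2 ρ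
          _ = ρ * _ + ρ * (n * (amax + 1)) := mul_add _ _ _
          _ ≤ _ := by
            exact add_le_add_right (mul_le_of_le_one_left zero_le hρ1) _
      calc _ ≤ ((ρ * optVal arr (stateAt τ ω s₀ (a :: h)).deficit n (h.length + 2)
            (stateAt τ ω s₀ (a :: h)).buf + n * (amax + 1) : ℝ≥0) : ℝ≥0∞) :=
            ENNReal.coe_le_coe.2 h3
        _ ≤ pathGain (amnd tie τ) ω s₀ n (a :: h) + (((amax + 1) * n ^ 2 : ℝ≥0) : ℝ≥0∞) +
            ((n * (amax + 1) : ℝ≥0) : ℝ≥0∞) := by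
            rw [ENNReal.coe_add]
            exact add_le_add_left (ih (a :: h)) _
        _ ≤ _ := by
          rw [add_assoc, ← ENNReal.coe_add]
          gcongr
          rw [hC, add_comm]
          exact mul_add_mul_sq_le n _
    change _ ≤ ∑ a, amndLaw tie b w a * _ + _
    by_cases hne : activeLinks tie b w = []
    -- No active link means empty buffers, so the optimum must idle too.
    · have hb0 : ∀ a : Decision L D, sentPacket a ≤ b → a = none := by
        intro a ha
        rcases a with _ | ⟨l, d⟩
        · rfl
        · have hpos : 0 < b l d := by
            have := ha l d
            simp only [sentPacket, if_true] at this
            omega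
          obtain ⟨i, hi, -⟩ := exists_mem_activeLinks (w := w) tie hpos
          rw [hne] at hi
          simp at hi
      rw [amndLaw_of_activeLinks_eq_nil tie hne, Finset.sum_eq_single none]
      · rw [PMF.pure_apply, if_pos rfl, one_mul, add_assoc]
        refine le_trans ?_ (le_add_self)
        refine le_trans (ENNReal.coe_le_coe.2 ?_) (hstep none)
        gcongr
        refine optVal_succ_le fun a ha => ?_
        rw [hb0 a ha]
        simp [packetWeight]
      · intro a _ ha
        simp [PMF.pure_apply, ha]
      · simp
    · rw [sum_amndLaw_mul tie hne]
      set q : L → ℝ≥0 := mixProb w 1 (activeLinks tie b w) with hq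
      have hq1 : ∑ l, (q l : ℝ≥0∞) = 1 := by
        rw [← ENNReal.ofNNReal_finsetSum, hq, sum_mixProb w 1 _ hne, ENNReal.coe_one]
      have hCsum : (C : ℝ≥0∞) = ∑ l, (q l : ℝ≥0∞) * C := by
        rw [← Finset.sum_mul, hq1, one_mul]
      rw [hCsum, ← Finset.sum_add_distrib]
      refine (ENNReal.coe_le_coe.2 (amnd_step tie hρ n (h.length + 1) hne)).trans ?_
      rw [ENNReal.ofNNReal_finsetSum]
      refine Finset.sum_le_sum fun l _ => ?_
      rw [← mul_add, ENNReal.coe_mul]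
      by_cases hl : l ∈ activeLinks tie b w
      · obtain ⟨d, -, hd, -⟩ := exists_of_mem_activeLinks tie hl
        refine mul_le_mul_right ?_ _
        rw [ENNReal.coe_add, gain_eq_packetWeight, hd]
        exact (add_le_add_right (hstep _) _).trans_eq (add_assoc _ _ _).symm
      · simp [hq, mixProb_eq_zero 1 hl]

end PathGain

/-! ### Return times of the traffic state -/

section Markov

variable {X L : Type*}

/-- The traffic does not visit `x` in the slots `m + 1, …, n`. -/
def avoid (x : X) (m n : ℕ) : Set (Path X L) := {ω | ∀ i, m < i → i ≤ n → (ω i).1 ≠ x}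

/-! ### Measurability of return times -/

section Measurability

variable [MeasurableSpace X] [DiscreteMeasurableSpace X]

theorem measurableSet_state_eq (n : ℕ) (y : X) : MeasurableSet {ω : Path X L | (ω n).1 = y} :=
  (measurable_fst.comp (measurable_pi_apply n)) (MeasurableSet.of_discrete (s := {y}))

theorem measurable_returnTime (x : X) (k : ℕ) :
    Measurable fun ω : Path X L => returnTime x ω k := by
  classical
  induction k with
  | zero => exact measurable_const
  | succ k ih =>
    have hp : ∀ n, MeasurableSet {ω : Path X L | returnTime x ω k < n ∧ (ω n).1 = x} := fun n =>
      (ih (MeasurableSet.of_discrete (s := Set.Iio n))).inter (measurableSet_state_eq n x)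
    -- The second alternative makes `Nat.find` return `0` on paths with no further visit, matching
    -- `sInf ∅ = 0`.
    have hex : ∀ ω : Path X L, ∃ n, (returnTime x ω k < n ∧ (ω n).1 = x) ∨
        ∀ m, ¬ (returnTime x ω k < m ∧ (ω m).1 = x) := by
      intro ω
      by_contra! h
      obtain ⟨m, hm⟩ := (h 0).2
      exact absurd hm.2 ((h m).1 hm.1)
    have hfind : (fun ω : Path X L => returnTime x ω (k + 1)) = fun ω => Nat.find (hex ω) := by
      funext ω
      rw [returnTime]
      by_cases h : ∃ m, returnTime x ω k < m ∧ (ω m).1 = x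
      · refine (le_antisymm (Nat.find_min' _ (Or.inl (Nat.sInf_mem h))) (Nat.sInf_le ?_)).symm
        rcases Nat.find_spec (hex ω) with h1 | h1
        · exact h1
        · exact absurd h (not_exists.2 h1)
      · have h0 : {n | returnTime x ω k < n ∧ (ω n).1 = x} = ∅ := by
          rw [Set.eq_empty_iff_forall_notMem]
          exact not_exists.1 h
        rw [h0, Nat.sInf_empty]
        exact ((Nat.find_eq_zero _).2 (Or.inr (not_exists.1 h))).symm
    rw [hfind]
    have hnone : MeasurableSet {ω : Path X L | ∀ m, ¬ (returnTime x ω k < m ∧ (ω m).1 = x)} := by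
      have : {ω : Path X L | ∀ m, ¬ (returnTime x ω k < m ∧ (ω m).1 = x)} =
          ⋂ m, {ω | returnTime x ω k < m ∧ (ω m).1 = x}ᶜ := by
        ext ω
        simp
      rw [this]
      exact MeasurableSet.iInter fun m => (hp m).compl
    exact measurable_find hex fun n => (hp n).union hnone

end Measurability

variable [Fintype X] [DecidableEq X]

/-- The transition matrix of the chain killed on entering `x`. -/
def killedMatrix (P : Matrix X X ℝ) (x : X) : Matrix X X ℝ :=
  fun u z => if z = x then 0 else P u z

/-! ### Geometric decay of the killed chain -/

section Killed

variable {P : Matrix X X ℝ} {x : X}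

theorem pow_nonneg_of_rowStochastic (hP : P ∈ Matrix.rowStochastic ℝ X) (n : ℕ) (u z : X) :
    0 ≤ (P ^ n) u z :=
  Matrix.nonneg_of_mem_rowStochastic (pow_mem hP n)

theorem killedMatrix_nonneg (hP : P ∈ Matrix.rowStochastic ℝ X) (u z : X) :
    0 ≤ killedMatrix P x u z := by
  unfold killedMatrix
  split_ifs
  · exact le_rfl
  · exact Matrix.nonneg_of_mem_rowStochastic hP

theorem killedMatrix_pow_nonneg (hP : P ∈ Matrix.rowStochastic ℝ X) (n : ℕ) (u z : X) :
    0 ≤ (killedMatrix P x ^ n) u z := by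
  induction n generalizing z with
  | zero =>
    rw [pow_zero, Matrix.one_apply]
    split_ifs <;> simp
  | succ n ih =>
    rw [pow_succ, Matrix.mul_apply]
    exact Finset.sum_nonneg fun v _ => mul_nonneg (ih v) (killedMatrix_nonneg hP v z)

theorem killedMatrix_pow_le (hP : P ∈ Matrix.rowStochastic ℝ X) (n : ℕ) (u z : X) :
    (killedMatrix P x ^ n) u z ≤ (P ^ n) u z := by
  induction n generalizing z with
  | zero => simp
  | succ n ih =>
    rw [pow_succ, pow_succ, Matrix.mul_apply, Matrix.mul_apply]
    refine Finset.sum_le_sum fun v _ => mul_le_mul (ih v) ?_ (killedMatrix_nonneg hP v z)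
      (pow_nonneg_of_rowStochastic hP n u v)
    unfold killedMatrix
    split_ifs
    · exact Matrix.nonneg_of_mem_rowStochastic hP
    · exact le_rfl

theorem killedMatrix_pow_succ_self (n : ℕ) (u : X) : (killedMatrix P x ^ (n + 1)) u x = 0 := by
  rw [pow_succ, Matrix.mul_apply]
  simp [killedMatrix]

theorem sum_killedMatrix_le_one (hP : P ∈ Matrix.rowStochastic ℝ X) (u : X) :
    ∑ z, killedMatrix P x u z ≤ 1 := by
  rw [← Matrix.sum_row_of_mem_rowStochastic hP u]
  have := killedMatrix_pow_le (x := x) hP 1 u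
  simp only [pow_one] at this
  exact Finset.sum_le_sum fun z _ => this z

theorem sum_killedMatrix_pow_add (m n : ℕ) (u : X) :
    ∑ z, (killedMatrix P x ^ (m + n)) u z =
      ∑ v, (killedMatrix P x ^ m) u v * ∑ z, (killedMatrix P x ^ n) v z := by
  simp only [pow_add, Matrix.mul_apply, Finset.mul_sum]
  rw [Finset.sum_comm]

theorem antitone_sum_killedMatrix_pow (hP : P ∈ Matrix.rowStochastic ℝ X) (u : X) :
    Antitone fun n => ∑ z, (killedMatrix P x ^ n) u z := by
  refine antitone_nat_of_succ_le fun n => ?_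
  rw [sum_killedMatrix_pow_add]
  refine Finset.sum_le_sum fun v _ => ?_
  rw [pow_one]
  exact mul_le_of_le_one_right (killedMatrix_pow_nonneg hP n u v) (sum_killedMatrix_le_one hP v)

/-- By irreducibility each row of some power of `P` charges `x`, mass which the killed power lacks.
Row sums of killed powers decrease with the exponent, so one `N` brings all of them below `1`. Their
maximum `θ` is a contraction factor per `N` steps. -/
theorem exists_sum_killedMatrix_pow_le (hP : P ∈ Matrix.rowStochastic ℝ X)
    (hirr : P.IsIrreducible) (x : X) :
    ∃ N > 0, ∃ θ : ℝ, 0 ≤ θ ∧ θ < 1 ∧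
      ∀ j u, ∑ z, (killedMatrix P x ^ (N * j)) u z ≤ θ ^ j := by
  have hpos := (Matrix.isIrreducible_iff_exists_pow_pos hirr.1).1 hirr
  choose n hn hn' using fun u => hpos u x
  have hlt : ∀ u, ∑ z, (killedMatrix P x ^ n u) u z < 1 := by
    intro u
    rw [← Matrix.sum_row_of_mem_rowStochastic (pow_mem hP (n u)) u]
    refine Finset.sum_lt_sum (fun z _ => killedMatrix_pow_le hP _ u z) ⟨x, Finset.mem_univ x, ?_⟩
    obtain ⟨m, hm⟩ := Nat.exists_eq_succ_of_ne_zero (hn u).ne'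
    have := hn' u
    rw [hm] at this ⊢
    rwa [killedMatrix_pow_succ_self]
  set N := Finset.univ.sup n
  have hN : ∀ u, n u ≤ N := fun u => Finset.le_sup (Finset.mem_univ u)
  obtain ⟨v, -, hv⟩ := Finset.exists_max_image Finset.univ
    (fun u => ∑ z, (killedMatrix P x ^ N) u z) ⟨x, Finset.mem_univ x⟩
  refine ⟨N, (hn x).trans_le (hN x), ∑ z, (killedMatrix P x ^ N) v z,
    Finset.sum_nonneg fun z _ => killedMatrix_pow_nonneg hP N v z,
    (antitone_sum_killedMatrix_pow hP v (hN v)).trans_lt (hlt v), fun j => ?_⟩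
  induction j with
  | zero => simp [Matrix.one_apply]
  | succ j ih =>
    intro u
    rw [Nat.mul_succ, sum_killedMatrix_pow_add, pow_succ]
    calc _ ≤ ∑ u', (killedMatrix P x ^ (N * j)) u u' * ∑ z, (killedMatrix P x ^ N) v z :=
          Finset.sum_le_sum fun u' _ => mul_le_mul_of_nonneg_left (hv u' (Finset.mem_univ _))
            (killedMatrix_pow_nonneg hP _ u u')
      _ ≤ _ := by
        rw [← Finset.sum_mul]
        exact mul_le_mul_of_nonneg_right (ih u)
          (Finset.sum_nonneg fun z _ => killedMatrix_pow_nonneg hP N v z)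

theorem exists_path_of_pow_pos (hP : P ∈ Matrix.rowStochastic ℝ X) (n : ℕ) (u z : X)
    (h : 0 < (P ^ n) u z) :
    ∃ y : ℕ → X, y 0 = u ∧ y n = z ∧ ∀ i < n, 0 < P (y i) (y (i + 1)) := by
  induction n generalizing z with
  | zero =>
    rw [pow_zero, Matrix.one_apply] at h
    have huz : u = z := by
      by_contra hne
      simp [hne] at h
    exact ⟨fun _ => u, rfl, huz, by simp⟩
  | succ n ih =>
    rw [pow_succ, Matrix.mul_apply] at h
    obtain ⟨v, -, hv⟩ := Finset.exists_lt_of_sum_lt (f := fun _ => (0 : ℝ)) (by simpa using h)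
    have h1 : 0 < (P ^ n) u v := (pow_nonneg_of_rowStochastic hP n u v).lt_of_ne' fun h0 => by
      simp [h0] at hv
    obtain ⟨y, hy0, hyn, hy⟩ := ih v h1
    refine ⟨fun i => if i ≤ n then y i else z, by simpa using hy0, by simp, fun i hi => ?_⟩
    rcases Nat.lt_succ_iff_lt_or_eq.1 hi with hi | rfl
    · simp only [hi.le, Nat.succ_le_iff.2 hi, if_true]
      exact hy i hi
    · simp only [le_rfl, if_true, hyn, Nat.not_succ_le_self, if_false]
      exact pos_of_mul_pos_right hv h1.le

/-- A shortest path works: an intermediate visit to `x` would allow it to be cut short. -/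
theorem exists_path_avoiding (hP : P ∈ Matrix.rowStochastic ℝ X) (hirr : P.IsIrreducible)
    (x z : X) : ∃ n > 0, ∃ y : ℕ → X, y 0 = x ∧ y n = z ∧ (∀ i < n, 0 < P (y i) (y (i + 1))) ∧
      ∀ i, 0 < i → i < n → y i ≠ x := by
  classical
  have hex : ∃ n, 0 < n ∧ ∃ y : ℕ → X, y 0 = x ∧ y n = z ∧ ∀ i < n, 0 < P (y i) (y (i + 1)) := by
    obtain ⟨n, hn, hpos⟩ := (Matrix.isIrreducible_iff_exists_pow_pos hirr.1).1 hirr x z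
    exact ⟨n, hn, exists_path_of_pow_pos hP n x z hpos⟩
  obtain ⟨hn, y, h0, hz, hy⟩ := Nat.find_spec hex
  refine ⟨_, hn, y, h0, hz, hy, fun i hi hin hix => Nat.find_min hex (m := Nat.find hex - i)
    (by omega) ⟨by omega, fun j => y (i + j), hix, ?_, fun j hj => ?_⟩⟩
  · change y (i + (Nat.find hex - i)) = z
    rwa [Nat.add_sub_cancel' hin.le]
  · exact hy (i + j) (by omega)

end Killed

/-! ### Avoidance probabilities and moments of return times -/

variable [MeasurableSpace X] [DiscreteMeasurableSpace X] {P : Matrix X X ℝ} {x : X}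
  {ν : Measure (Path X L)}

omit [DecidableEq X] in
theorem measure_eq_sum_state (A : Set (Path X L)) (n : ℕ) :
    ν A = ∑ u, ν (A ∩ {ω | (ω n).1 = u}) := by
  have hf : Measurable fun ω : Path X L => (ω n).1 := measurable_fst.comp (measurable_pi_apply n)
  have h := sum_measure_preimage_singleton (μ := ν.restrict A) (Finset.univ : Finset X)
    (f := fun ω : Path X L => (ω n).1) fun y _ => measurableSet_state_eq n y
  rw [Finset.coe_univ, Set.preimage_univ, Measure.restrict_apply_univ] at h
  rw [← h]
  refine Finset.sum_congr rfl fun u _ => ?_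
  exact (Measure.restrict_apply (measurableSet_state_eq n u)).trans
    (congrArg ν (Set.inter_comm _ _))

omit [DecidableEq X] in
theorem measureReal_eq_sum_state [IsFiniteMeasure ν] (A : Set (Path X L)) (n : ℕ) :
    ν.real A = ∑ u, ν.real (A ∩ {ω | (ω n).1 = u}) := by
  simp only [measureReal_def]
  rw [measure_eq_sum_state A n, ENNReal.toReal_sum fun u _ => measure_ne_top ν _]

/-- The Markov property for events that depend on the traffic up to time `n`. -/
theorem measure_inter_next_state (hP : P ∈ Matrix.rowStochastic ℝ X) (hν : IsMarkovFrom P x ν)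
    (n : ℕ) (S : Set (Fin (n + 1) → X)) (u z : X) :
    ν ({ω | (fun i : Fin (n + 1) => (ω i).1) ∈ S} ∩ {ω | (ω n).1 = u} ∩ {ω | (ω (n + 1)).1 = z}) =
      ν ({ω | (fun i : Fin (n + 1) => (ω i).1) ∈ S} ∩ {ω | (ω n).1 = u}) *
        ENNReal.ofReal (P u z) := by
  classical
  set f : Path X L → Fin (n + 1) → X := fun ω i => (ω i).1
  have hf : ∀ v, MeasurableSet (f ⁻¹' {v}) := by
    intro v
    have : f ⁻¹' {v} = ⋂ i : Fin (n + 1), {ω : Path X L | (ω i).1 = v i} := by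
      ext ω
      simp [f, funext_iff]
    rw [this]
    exact MeasurableSet.iInter fun i => measurableSet_state_eq i (v i)
  set F : Finset (Fin (n + 1) → X) := Finset.univ.filter fun v => v ∈ S ∧ v (Fin.last n) = u with hF
  have hset : {ω | f ω ∈ S} ∩ {ω : Path X L | (ω n).1 = u} = f ⁻¹' F := by
    ext ω
    simp [hF, f]
  change ν ({ω | f ω ∈ S} ∩ {ω : Path X L | (ω n).1 = u} ∩ _) =
    ν ({ω | f ω ∈ S} ∩ {ω : Path X L | (ω n).1 = u}) * _
  rw [hset, ← Measure.restrict_apply' (measurableSet_state_eq (n + 1) z),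
    ← sum_measure_preimage_singleton F fun v _ => hf v,
    ← sum_measure_preimage_singleton F fun v _ => hf v, Finset.sum_mul]
  refine Finset.sum_congr rfl fun v hv => ?_
  rw [Measure.restrict_apply (hf v)]
  -- The event is a finite union of cylinders. This `y` describes a cylinder up to time `n` and its
  -- extension by `z`, so the cylinder formula applies to both.
  set y : ℕ → X := fun i => if h : i < n + 1 then v ⟨i, h⟩ else z with hy
  have h1 : f ⁻¹' {v} = {ω : Path X L | ∀ i ≤ n, (ω i).1 = y i} := by
    ext ω
    simp only [Set.mem_preimage, Set.mem_singleton_iff, funext_iff, Set.mem_ofPred_eq, f, hy]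
    constructor
    · intro h i hi
      rw [dif_pos (Nat.lt_succ_of_le hi)]
      exact h ⟨i, Nat.lt_succ_of_le hi⟩
    · intro h i
      have := h i (Nat.le_of_lt_succ i.2)
      rwa [dif_pos i.2] at this
  have hyz : y (n + 1) = z := by simp [hy]
  have hyu : y n = u := by
    have := (Finset.mem_filter.1 hv).2.2
    simpa [hy, Fin.last] using this
  have h2 : f ⁻¹' {v} ∩ {ω : Path X L | (ω (n + 1)).1 = z} =
      {ω : Path X L | ∀ i ≤ n + 1, (ω i).1 = y i} := by
    rw [h1]
    ext ω
    constructor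
    · rintro ⟨ha, hb⟩ i hi
      rcases Nat.le_succ_iff.1 hi with hi | rfl
      · exact ha i hi
      · rw [hyz]
        exact hb
    · intro h
      exact ⟨fun i hi => h i (hi.trans n.le_succ), (h (n + 1) le_rfl).trans hyz⟩
  rw [h2, h1, hν, hν]
  split_ifs
  · rw [Finset.prod_range_succ, hyz, hyu, ENNReal.ofReal_mul]
    exact Finset.prod_nonneg fun i _ => Matrix.nonneg_of_mem_rowStochastic hP
  · simp

variable [IsProbabilityMeasure ν]

theorem measureReal_avoid_inter (hP : P ∈ Matrix.rowStochastic ℝ X) (hν : IsMarkovFrom P x ν)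
    (m n : ℕ) (z : X) :
    ν.real (avoid x m (m + n) ∩ {ω | (ω (m + n)).1 = z}) =
      ∑ y, ν.real {ω | (ω m).1 = y} * (killedMatrix P x ^ n) y z := by
  induction n generalizing z with
  | zero =>
    have : (avoid x m (m + 0) : Set (Path X L)) = Set.univ := by
      ext ω
      simp only [avoid, Set.mem_ofPred_eq, Set.mem_univ, iff_true]
      omega
    rw [this]
    simp [Matrix.one_apply]
  | succ n ih =>
    by_cases hz : z = x
    · subst hz
      have : (avoid z m (m + (n + 1)) ∩ {ω : Path X L | (ω (m + (n + 1))).1 = z}) = ∅ := by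
        rw [Set.eq_empty_iff_forall_notMem]
        rintro ω ⟨h1, h2⟩
        exact h1 _ (by omega) le_rfl h2
      rw [this]
      simp [killedMatrix_pow_succ_self]
    · have hset : (avoid x m (m + (n + 1)) ∩ {ω : Path X L | (ω (m + (n + 1))).1 = z}) =
          avoid x m (m + n) ∩ {ω : Path X L | (ω (m + n + 1)).1 = z} := by
        ext ω
        constructor
        · rintro ⟨h1, h2⟩
          exact ⟨fun i hi hi' => h1 i hi (by omega), h2⟩
        · rintro ⟨h1, h2⟩
          refine ⟨fun i hi hi' => ?_, h2⟩
          rcases Nat.le_succ_iff.1 hi' with hi' | rfl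
          · exact h1 i hi hi'
          · exact fun h => hz (h2.symm.trans h)
      rw [hset, measureReal_eq_sum_state _ (m + n)]
      have hstep : ∀ u, ν.real (avoid x m (m + n) ∩ {ω : Path X L | (ω (m + n + 1)).1 = z} ∩
          {ω | (ω (m + n)).1 = u}) = ν.real (avoid x m (m + n) ∩ {ω | (ω (m + n)).1 = u}) *
            P u z := by
        intro u
        have hav : (avoid x m (m + n) : Set (Path X L)) =
            {ω | (fun i : Fin (m + n + 1) => (ω i).1) ∈
              {v : Fin (m + n + 1) → X | ∀ i : Fin (m + n + 1), m < i → v i ≠ x}} := by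
          ext ω
          constructor
          · exact fun h i hi => h i hi (Nat.le_of_lt_succ i.2)
          · exact fun h i hi hi' => h ⟨i, Nat.lt_succ_of_le hi'⟩ hi
        have := measure_inter_next_state hP hν (m + n)
          {v : Fin (m + n + 1) → X | ∀ i : Fin (m + n + 1), m < i → v i ≠ x} u z
        rw [← hav] at this
        rw [Set.inter_right_comm, measureReal_def, this, ENNReal.toReal_mul,
          ENNReal.toReal_ofReal (Matrix.nonneg_of_mem_rowStochastic hP), measureReal_def]
      simp only [hstep, ih, Finset.sum_mul]
      rw [Finset.sum_comm]
      refine Finset.sum_congr rfl fun y _ => ?_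
      rw [pow_succ, Matrix.mul_apply, Finset.mul_sum]
      refine Finset.sum_congr rfl fun u _ => ?_
      simp [killedMatrix, hz, mul_assoc]

theorem measureReal_avoid_le (hP : P ∈ Matrix.rowStochastic ℝ X) (hν : IsMarkovFrom P x ν)
    {n : ℕ} {c : ℝ} (hc : ∀ u, ∑ z, (killedMatrix P x ^ n) u z ≤ c) (m : ℕ) :
    ν.real (avoid x m (m + n)) ≤ c := by
  rw [measureReal_eq_sum_state _ (m + n)]
  simp only [measureReal_avoid_inter hP hν]
  rw [Finset.sum_comm]
  have h1 : ∑ y, ν.real {ω : Path X L | (ω m).1 = y} = 1 := by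
    have := measureReal_eq_sum_state (ν := ν) Set.univ m
    simpa using this.symm
  calc _ ≤ ∑ y, ν.real {ω : Path X L | (ω m).1 = y} * c := by
        refine Finset.sum_le_sum fun y _ => ?_
        rw [← Finset.mul_sum]
        exact mul_le_mul_of_nonneg_left (hc y) measureReal_nonneg
    _ = c := by rw [← Finset.sum_mul, h1, one_mul]

omit [Fintype X] [DecidableEq X] [DiscreteMeasurableSpace X] in
-- Doubling the horizon avoids the strong Markov property. If return `k + 1` comes after `2 * A`,
-- then return `k` comes after `A` or the deterministic window from `A + 1` to `2 * A` misses `x`.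
theorem measureReal_lt_returnTime_le {N : ℕ} {θ : ℝ} (hθ0 : 0 ≤ θ) (hθ1 : θ ≤ 1)
    (h : ∀ m j, ν.real (avoid x m (m + N * j)) ≤ θ ^ j) (k j : ℕ) :
    ν.real {ω | 2 ^ k * N * j < returnTime x ω k} ≤ k * θ ^ j := by
  induction k with
  | zero => simp [returnTime]
  | succ k ih =>
    set A := 2 ^ k * N * j with hA
    have hsub : {ω : Path X L | 2 ^ (k + 1) * N * j < returnTime x ω (k + 1)} ⊆
        {ω | A < returnTime x ω k} ∪ avoid x A (A + N * (2 ^ k * j)) := by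
      intro ω hω
      by_contra hcon
      simp only [Set.mem_union, not_or, Set.mem_ofPred_eq, not_lt, avoid, not_forall,
        not_not] at hcon
      obtain ⟨h1, i, h2, h3, h4⟩ := hcon
      have h5 : returnTime x ω (k + 1) ≤ i := Nat.sInf_le ⟨h1.trans_lt h2, h4⟩
      have h6 : 2 ^ (k + 1) * N * j = A + N * (2 ^ k * j) := by
        rw [hA]
        ring
      simp only [Set.mem_ofPred_eq] at hω
      omega
    calc _ ≤ ν.real ({ω | A < returnTime x ω k} ∪ avoid x A (A + N * (2 ^ k * j))) :=
          measureReal_mono hsub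
      _ ≤ k * θ ^ j + θ ^ (2 ^ k * j) := (measureReal_union_le _ _).trans (add_le_add ih (h _ _))
      _ ≤ k * θ ^ j + θ ^ j := by
        exact add_le_add_right (pow_le_pow_of_le_one hθ0 hθ1
          (Nat.le_mul_of_pos_left _ (Nat.two_pow_pos k))) _
      _ = _ := by
        push_cast
        ring

theorem exists_measureReal_avoid_le (hP : P ∈ Matrix.rowStochastic ℝ X) (hirr : P.IsIrreducible)
    (hν : IsMarkovFrom P x ν) : ∃ N > 0, ∃ θ : ℝ, 0 ≤ θ ∧ θ < 1 ∧
      ∀ m j, ν.real (avoid x m (m + N * j)) ≤ θ ^ j := by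
  obtain ⟨N, hN, θ, hθ0, hθ1, h⟩ := exists_sum_killedMatrix_pow_le hP hirr x
  exact ⟨N, hN, θ, hθ0, hθ1, fun m j => measureReal_avoid_le hP hν (h j) m⟩

/-- The second moment is what the quadratic path error requires. Cutting time into blocks of length
`M` bounds it by a series of a quadratic polynomial times `θ ^ j`. -/
theorem lintegral_returnTime_sq_lt_top (hP : P ∈ Matrix.rowStochastic ℝ X)
    (hirr : P.IsIrreducible) (hν : IsMarkovFrom P x ν) (k : ℕ) :
    ∫⁻ ω, (returnTime x ω k : ℝ≥0∞) ^ 2 ∂ν < ⊤ := by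
  obtain ⟨N, hN, θ, hθ0, hθ1, h⟩ := exists_measureReal_avoid_le hP hirr hν
  set M := 2 ^ k * N with hM
  have hMpos : 0 < M := by positivity
  set S : ℕ → Set (Path X L) := fun j => {ω | M * j < returnTime x ω k} with hS
  have hSm : ∀ j, MeasurableSet (S j) := fun j =>
    (measurable_returnTime x k) (MeasurableSet.of_discrete (s := Set.Ioi (M * j)))
  set c : ℕ → ℝ := fun j => ((M : ℝ) * (j + 1)) ^ 2 with hc
  have hpt : ∀ ω : Path X L, (returnTime x ω k : ℝ≥0∞) ^ 2 ≤
      ∑' j, (S j).indicator (fun _ => ENNReal.ofReal (c j)) ω := by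
    intro ω
    rcases Nat.eq_zero_or_pos (returnTime x ω k) with h0 | h0
    · simp [h0]
    · set T := returnTime x ω k
      -- The block index with `M * j < T ≤ M * (j + 1)`; the shift by one makes the left inequality
      -- strict.
      set j := (T - 1) / M with hj
      have h1 : M * j < T := by
        have := Nat.mul_div_le (T - 1) M
        rw [← hj] at this
        omega
      have h2 : T ≤ M * (j + 1) := by
        have := Nat.lt_mul_div_succ (T - 1) hMpos
        rw [← hj] at this
        omega
      refine le_trans ?_ (ENNReal.le_tsum j)
      rw [Set.indicator_of_mem (show ω ∈ S j from h1), ← ENNReal.ofReal_natCast,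
        ← ENNReal.ofReal_pow (by positivity)]
      refine ENNReal.ofReal_le_ofReal ?_
      simp only [hc]
      gcongr
      exact_mod_cast h2
  have hsum : Summable fun j => c j * (k * θ ^ j) := by
    have hn : ‖θ‖ < 1 := by rwa [Real.norm_of_nonneg hθ0]
    have h2 := summable_pow_mul_geometric_of_norm_lt_one 2 hn
    have h1 := summable_pow_mul_geometric_of_norm_lt_one 1 hn
    have h0 := summable_pow_mul_geometric_of_norm_lt_one 0 hn
    refine (((h2.add (h1.mul_left 2)).add h0).mul_left ((M : ℝ) ^ 2 * k)).congr fun j => ?_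
    simp only [hc]
    ring
  calc _ ≤ ∫⁻ ω, ∑' j, (S j).indicator (fun _ => ENNReal.ofReal (c j)) ω ∂ν := lintegral_mono hpt
    _ = ∑' j, ENNReal.ofReal (c j) * ν (S j) := by
      rw [lintegral_tsum fun j => (measurable_const.indicator (hSm j)).aemeasurable]
      exact tsum_congr fun j => lintegral_indicator_const (hSm j) _
    _ ≤ ∑' j, ENNReal.ofReal (c j * (k * θ ^ j)) := by
      refine ENNReal.tsum_le_tsum fun j => ?_
      rw [ENNReal.ofReal_mul (by positivity), ← ofReal_measureReal]
      gcongr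
      exact measureReal_lt_returnTime_le hθ0 hθ1.le h k j
    _ < ⊤ := hsum.tsum_ofReal_lt_top

theorem ae_exists_visit (hP : P ∈ Matrix.rowStochastic ℝ X) (hirr : P.IsIrreducible)
    (hν : IsMarkovFrom P x ν) : ∀ᵐ ω ∂ν, ∀ m, ∃ i, m < i ∧ (ω i).1 = x := by
  obtain ⟨N, hN, θ, hθ0, hθ1, h⟩ := exists_measureReal_avoid_le hP hirr hν
  rw [ae_all_iff]
  intro m
  rw [ae_iff, ← measureReal_eq_zero_iff]
  refine le_antisymm (ge_of_tendsto' (tendsto_pow_atTop_nhds_zero_of_lt_one hθ0 hθ1) fun j => ?_)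
    measureReal_nonneg
  refine (measureReal_mono ?_).trans (h m j)
  intro ω hω i hi _ hix
  exact hω ⟨i, hi, hix⟩

/-- Every state is visited with positive probability before the frame ends. -/
theorem exists_visit_pos (hP : P ∈ Matrix.rowStochastic ℝ X) (hirr : P.IsIrreducible)
    (hν : IsMarkovFrom P x ν) (z : X) (k : ℕ) :
    ∃ n > 0, 0 < ν {ω | n ≤ returnTime x ω (k + 1) ∧ (ω n).1 = z} := by
  obtain ⟨n, hn, y, h0, hz, hy, hav⟩ := exists_path_avoiding hP hirr x z
  refine ⟨n, hn, ?_⟩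
  have hcyl : 0 < ν {ω : Path X L | ∀ i ≤ n, (ω i).1 = y i} := by
    rw [hν, if_pos h0, ENNReal.ofReal_pos]
    exact Finset.prod_pos fun i hi => hy i (Finset.mem_range.1 hi)
  refine hcyl.trans_le (measure_mono_ae ?_)
  filter_upwards [ae_exists_visit hP hirr hν] with ω hω hcyl
  refine ⟨?_, (hcyl n le_rfl).trans hz⟩
  -- Almost surely the infimum is over a nonempty set, so return times are genuine and not the
  -- default `0`.
  have hmem : ∀ k, returnTime x ω k < returnTime x ω (k + 1) ∧ (ω (returnTime x ω (k + 1))).1 = x :=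
    fun k => Nat.sInf_mem (hω (returnTime x ω k))
  have h1 : n ≤ returnTime x ω 1 := by
    by_contra hlt
    rw [not_le] at hlt
    exact hav _ (hmem 0).1 hlt ((hcyl _ hlt.le).symm.trans (hmem 0).2)
  exact h1.trans ((strictMono_nat_of_lt_succ fun k => (hmem k).1).monotone (Nat.le_add_left 1 k))

end Markov

/-! ### Gains over a frame -/

section Frame

variable {X L : Type*} [MeasurableSpace X] [Fintype L] [DecidableEq L] {D : ℕ}
  {τ : X → L → Fin D → ℕ} {ν : Measure (Path X L)} {amax : ℝ≥0}

theorem frameGain_lt_top [IsFiniteMeasure ν] (hda : ∀ᵐ ω ∂ν, ∀ n l, (ω n).2 l ≤ amax)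
    {x : X} {k : ℕ} (hT : ∫⁻ ω, (returnTime x ω k : ℝ≥0∞) ^ 2 ∂ν < ⊤) (π : Policy τ)
    (s₀ : NetState L D) : frameGain ν x k π s₀ < ⊤ := by
  set c : ℝ≥0 := ∑ l, s₀.deficit l + (amax + 1) with hc
  have hpt : ∀ᵐ ω ∂ν, pathGain π ω s₀ (returnTime x ω k) [] ≤
      (c : ℝ≥0∞) * (returnTime x ω k : ℝ≥0∞) ^ 2 := by
    filter_upwards [hda] with ω hω
    set n := returnTime x ω k
    refine (pathGain_le_optVal ω s₀ hω π n []).trans ?_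
    have h1 := optVal_le (arr := fun i => τ (ω i).1) (w := (stateAt τ ω s₀ []).deficit) n
      (([] : List (Decision L D)).length + 1) (stateAt τ ω s₀ []).buf
    have h2 : (c : ℝ≥0∞) * (n : ℝ≥0∞) ^ 2 = ((c * (n : ℝ≥0) ^ 2 : ℝ≥0) : ℝ≥0∞) := by push_cast; rfl
    have h3 : (n : ℝ≥0) ≤ (n : ℝ≥0) ^ 2 := by exact_mod_cast Nat.le_self_pow two_ne_zero n
    rw [h2, ENNReal.coe_le_coe, hc, add_mul (∑ l, s₀.deficit l)]
    refine add_le_add_left (h1.trans ?_) _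
    rw [mul_comm]
    exact mul_le_mul_right h3 _
  calc frameGain ν x k π s₀ ≤ ∫⁻ ω, (c : ℝ≥0∞) * (returnTime x ω k : ℝ≥0∞) ^ 2 ∂ν :=
        lintegral_mono_ae hpt
    _ = c * ∫⁻ ω, (returnTime x ω k : ℝ≥0∞) ^ 2 ∂ν := lintegral_const_mul' _ _ ENNReal.coe_ne_top
    _ < ⊤ := ENNReal.mul_lt_top ENNReal.coe_lt_top hT

variable [DiscreteMeasurableSpace X] (tie : TieBreak L) {ρ : ℝ≥0}

/-- Chains the two pathwise bounds through `optVal` and integrates. The additive error does not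
involve `s₀`. -/
theorem mul_frameGain_le (hda : ∀ᵐ ω ∂ν, ∀ n l, (ω n).2 l ≤ amax)
    (hρ : (ρ : ℝ) ≤ 1 - (1 - 1 / (Fintype.card L : ℝ)) ^ Fintype.card L) (hρ1 : ρ ≤ 1)
    (x : X) (k : ℕ) (π : Policy τ) (s₀ : NetState L D) :
    ρ * frameGain ν x k π s₀ ≤ frameGain ν x k (amnd tie τ) s₀ +
      2 * (amax + 1) * ∫⁻ ω, (returnTime x ω k : ℝ≥0∞) ^ 2 ∂ν := by
  have hm : Measurable fun ω : Path X L => (returnTime x ω k : ℝ≥0∞) ^ 2 :=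
    (Measurable.of_discrete.comp (measurable_returnTime x k)).pow_const 2
  have hpt : ∀ᵐ ω ∂ν, ρ * pathGain π ω s₀ (returnTime x ω k) [] ≤
      pathGain (amnd tie τ) ω s₀ (returnTime x ω k) [] +
        2 * (amax + 1) * (returnTime x ω k : ℝ≥0∞) ^ 2 := by
    filter_upwards [hda] with ω hω
    set n := returnTime x ω k
    have h1 := pathGain_le_optVal ω s₀ hω π n []
    have h2 := optVal_le_pathGain_amnd (τ := τ) (amax := amax) ω s₀ tie hρ hρ1 n []
    set V := optVal (fun i => τ (ω i).1) (stateAt τ ω s₀ []).deficit n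
      (([] : List (Decision L D)).length + 1) (stateAt τ ω s₀ []).buf
    have hq : (((amax + 1) * n ^ 2 : ℝ≥0) : ℝ≥0∞) = (amax + 1) * (n : ℝ≥0∞) ^ 2 := by
      push_cast
      rfl
    calc _ ≤ (ρ : ℝ≥0∞) * ((V + (amax + 1) * n ^ 2 : ℝ≥0) : ℝ≥0∞) := by gcongr
      _ = ((ρ * V : ℝ≥0) : ℝ≥0∞) + ((ρ * ((amax + 1) * n ^ 2) : ℝ≥0) : ℝ≥0∞) := by
        rw [← ENNReal.coe_mul, mul_add, ENNReal.coe_add]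
      _ ≤ (pathGain (amnd tie τ) ω s₀ n [] + (((amax + 1) * n ^ 2 : ℝ≥0) : ℝ≥0∞)) +
          (((amax + 1) * n ^ 2 : ℝ≥0) : ℝ≥0∞) := by
        refine add_le_add h2 (ENNReal.coe_le_coe.2 ?_)
        exact mul_le_of_le_one_left zero_le hρ1
      _ = _ := by
        rw [hq, add_assoc, ← two_mul, mul_assoc]
  unfold frameGain
  rw [← lintegral_const_mul' _ _ ENNReal.coe_ne_top, ← lintegral_const_mul _ hm,
    ← lintegral_add_right _ (hm.const_mul _)]
  exact lintegral_mono_ae hpt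

/-- If an arrival on link `l` occurs during the frame with positive probability, then the gain of
AMND grows linearly with the initial deficit of `l`. -/
theorem mul_deficit_le_frameGain
    (hρ : (ρ : ℝ) ≤ 1 - (1 - 1 / (Fintype.card L : ℝ)) ^ Fintype.card L) (hρ1 : ρ ≤ 1) (amax : ℝ≥0)
    (x : X) (k : ℕ) (s₀ : NetState L D) {l : L} {d : Fin D} {z : X} (hz : 0 < τ z l d) {n : ℕ}
    (hn : 0 < n) :
    ρ * s₀.deficit l * ν {ω | n ≤ returnTime x ω k ∧ (ω n).1 = z} ≤
      frameGain ν x k (amnd tie τ) s₀ +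
        (amax + 1) * ∫⁻ ω, (returnTime x ω k : ℝ≥0∞) ^ 2 ∂ν := by
  have hm : Measurable fun ω : Path X L => (returnTime x ω k : ℝ≥0∞) ^ 2 :=
    (Measurable.of_discrete.comp (measurable_returnTime x k)).pow_const 2
  set E : Set (Path X L) := {ω | n ≤ returnTime x ω k ∧ (ω n).1 = z} with hE
  have hEm : MeasurableSet E :=
    ((measurable_returnTime x k) (MeasurableSet.of_discrete (s := Set.Ici n))).inter
      (measurableSet_state_eq n z)
  have hpt : ∀ ω, E.indicator (fun _ => (ρ * s₀.deficit l : ℝ≥0∞)) ω ≤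
      pathGain (amnd tie τ) ω s₀ (returnTime x ω k) [] +
        (amax + 1) * (returnTime x ω k : ℝ≥0∞) ^ 2 := by
    intro ω
    by_cases hω : ω ∈ E
    · rw [Set.indicator_of_mem hω]
      set N := returnTime x ω k
      have h2 := optVal_le_pathGain_amnd (τ := τ) (amax := amax) ω s₀ tie hρ hρ1 N []
      -- The first slot of the frame is `1`, so an arrival in slot `n` has offset `n - 1`.
      have h3 := le_optVal_of_arrival (arr := fun i => τ (ω i).1)
        (w := (stateAt τ ω s₀ []).deficit) (n := N) (t := 1) (i := n - 1) (l := l) (d := d)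
        (stateAt τ ω s₀ []).buf (fun l d => Nat.le_add_left _ _) (by
          rwa [Nat.add_sub_cancel' hn, hω.2]) (by
          have : n ≤ N := hω.1
          omega)
      have hq : (((amax + 1) * N ^ 2 : ℝ≥0) : ℝ≥0∞) = (amax + 1) * (N : ℝ≥0∞) ^ 2 := by
        push_cast
        rfl
      rw [hq] at h2
      refine le_trans ?_ h2
      rw [← ENNReal.coe_mul, ENNReal.coe_le_coe]
      exact mul_le_mul_right h3 ρ
    · rw [Set.indicator_of_notMem hω]
      exact zero_le
  unfold frameGain
  rw [← lintegral_indicator_const hEm, ← lintegral_const_mul _ hm,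
    ← lintegral_add_right _ (hm.const_mul _)]
  exact lintegral_mono hpt

omit [DiscreteMeasurableSpace X] in
theorem frameGain_zero (x : X) (π : Policy τ) (s₀ : NetState L D) : frameGain ν x 0 π s₀ = 0 := by
  simp [frameGain, returnTime, pathGain]

omit [DiscreteMeasurableSpace X] in
theorem pathGain_of_isEmpty [IsEmpty L] (π : Policy τ) (ω : Path X L) (s₀ : NetState L D) (n : ℕ)
    (h : List (Decision L D)) : pathGain π ω s₀ n h = 0 := by
  induction n generalizing h with
  | zero => rfl
  | succ n ih => simp [pathGain, ih, gain]

omit [DiscreteMeasurableSpace X] in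
theorem frameGain_of_isEmpty [IsEmpty L] (x : X) (k : ℕ) (π : Policy τ) (s₀ : NetState L D) :
    frameGain ν x k π s₀ = 0 := by
  simp [frameGain, pathGain_of_isEmpty]

end Frame

/-! ### Range of the ratio and choice of the threshold -/

theorem ratio_pos {K : ℕ} (hK : 0 < K) : 0 < 1 - (1 - 1 / (K : ℝ)) ^ K := by
  have h1 : (1 : ℝ) ≤ K := by exact_mod_cast hK
  have h2 : 1 / (K : ℝ) ≤ 1 := by rwa [div_le_one (by linarith)]
  have h3 : 0 < 1 / (K : ℝ) := by positivity
  have := pow_lt_one₀ (sub_nonneg.2 h2) (sub_lt_self 1 h3) hK.ne'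
  linarith

theorem ratio_le_one {K : ℕ} (hK : 0 < K) : 1 - (1 - 1 / (K : ℝ)) ^ K ≤ 1 := by
  have h1 : (1 : ℝ) ≤ K := by exact_mod_cast hK
  have h2 : 1 / (K : ℝ) ≤ 1 := by rwa [div_le_one (by linarith)]
  have := pow_nonneg (sub_nonneg.2 h2) K
  linarith

end RealTimeScheduling

open RealTimeScheduling in
theorem mainTheorem5 {X L : Type*} [Fintype X] [DecidableEq X] [MeasurableSpace X]
    [DiscreteMeasurableSpace X] [Fintype L] [DecidableEq L] {D : ℕ}
    -- the traffic: an irreducible finite chain, arrivals, and the law of traffic and deficit arrivals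
    (P : Matrix X X ℝ) (hP : P ∈ Matrix.rowStochastic ℝ X) (hirr : P.IsIrreducible)
    (τ : X → L → Fin D → ℕ) (hτ : ∀ l, ∃ y d, 0 < τ y l d)
    (x : X) (ν : MeasureTheory.Measure (Path X L)) [MeasureTheory.IsProbabilityMeasure ν]
    (hν : IsMarkovFrom P x ν)
    (amax : NNReal) (hda : ∀ᵐ ω ∂ν, ∀ n l, (ω n).2 l ≤ amax)
    (k : ℕ) (tie : TieBreak L) (μ : Policy τ) (ε : ℝ) (hε : 0 < ε) :
    ∃ W' : ℝ, ∀ s₀ : NetState L D, W' ≤ ∑ l, (s₀.deficit l : ℝ) →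
      frameGain ν x k (amnd tie τ) s₀ < ⊤ ∧ frameGain ν x k μ s₀ < ⊤ ∧
      ((1 - (1 - 1 / (Fintype.card L : ℝ)) ^ Fintype.card L) - ε) * (frameGain ν x k μ s₀).toReal
        ≤ (frameGain ν x k (amnd tie τ) s₀).toReal := by
  rcases isEmpty_or_nonempty L with hL | hL
  · exact ⟨0, fun s₀ _ => by simp [frameGain_of_isEmpty]⟩
  -- A frame of zero cycles has no slots; `exists_visit_pos` needs at least one cycle.
  rcases k with _ | k
  · exact ⟨0, fun s₀ _ => by simp [frameGain_zero]⟩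
  have hK : 0 < Fintype.card L := Fintype.card_pos
  set K := Fintype.card L
  obtain ⟨ρ, hρ⟩ : ∃ ρ : ℝ≥0, (ρ : ℝ) = 1 - (1 - 1 / (K : ℝ)) ^ K :=
    ⟨⟨_, (ratio_pos hK).le⟩, rfl⟩
  have hρpos : (0 : ℝ) < ρ := hρ ▸ ratio_pos hK
  have hρ1 : ρ ≤ 1 := by
    rw [← NNReal.coe_le_coe, hρ]
    exact ratio_le_one hK
  have hT := lintegral_returnTime_sq_lt_top hP hirr hν (k + 1)
  set I := ∫⁻ ω, (returnTime x ω (k + 1) : ℝ≥0∞) ^ 2 ∂ν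
  choose z d hz using hτ
  choose n hn hvisit using fun l => exists_visit_pos hP hirr hν (z l) k
  set p : L → ℝ := fun l => ν.real {ω | n l ≤ returnTime x ω (k + 1) ∧ (ω (n l)).1 = z l} with hp
  have hppos : ∀ l, 0 < p l := fun l => ENNReal.toReal_pos (hvisit l).ne' (measure_ne_top ν _)
  obtain ⟨l₀, -, hl₀⟩ := Finset.exists_min_image Finset.univ p Finset.univ_nonempty
  set B : ℝ := (amax + 1) * I.toReal with hB
  have hB0 : 0 ≤ B := by positivity
  -- The largest deficit is at least the sum over `K`. As `ρ * s₀.deficit l * p l ≤ A + B` and `p l₀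
  -- ≤ p l`, this threshold forces AMND's gain `A` to be at least `2 * B * ρ / ε`, enough for `ε *
  -- A` to cover the error in `ρ * M ≤ A + 2 * B`.
  refine ⟨K * ((2 * B * ρ / ε + B) / (ρ * p l₀)), fun s₀ hs₀ => ?_⟩
  have hA := frameGain_lt_top hda hT (amnd tie τ) s₀
  have hM := frameGain_lt_top hda hT μ s₀
  refine ⟨hA, hM, ?_⟩
  rw [← hρ]
  have hadd := mul_frameGain_le tie hda hρ.le hρ1 x (k + 1) μ s₀
  obtain ⟨l, -, hl⟩ := Finset.exists_max_image Finset.univ s₀.deficit Finset.univ_nonempty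
  have hlow := mul_deficit_le_frameGain (ν := ν) tie hρ.le hρ1 amax x (k + 1) s₀ (hz l) (hn l)
  have hc : ((amax : ℝ≥0∞) + 1) ≠ ⊤ := ENNReal.add_ne_top.2 ⟨ENNReal.coe_ne_top, ENNReal.one_ne_top⟩
  have hcI : ((amax : ℝ≥0∞) + 1) * I ≠ ⊤ := ENNReal.mul_ne_top hc hT.ne
  have hcB : (((amax : ℝ≥0∞) + 1) * I).toReal = B := by
    rw [ENNReal.toReal_mul, ENNReal.toReal_add ENNReal.coe_ne_top ENNReal.one_ne_top]
    rfl
  set A := frameGain ν x (k + 1) (amnd tie τ) s₀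
  set M := frameGain ν x (k + 1) μ s₀
  have hadd' : (ρ : ℝ) * M.toReal ≤ A.toReal + 2 * B := by
    rw [mul_assoc] at hadd
    have hfin : 2 * (((amax : ℝ≥0∞) + 1) * I) ≠ ⊤ := ENNReal.mul_ne_top (by simp) hcI
    have := ENNReal.toReal_mono (ENNReal.add_ne_top.2 ⟨hA.ne, hfin⟩) hadd
    rwa [ENNReal.toReal_mul, ENNReal.toReal_add hA.ne hfin, ENNReal.toReal_mul, hcB] at this
  have hlow' : (ρ : ℝ) * s₀.deficit l * p l ≤ A.toReal + B := by
    have := ENNReal.toReal_mono (ENNReal.add_ne_top.2 ⟨hA.ne, hcI⟩) hlow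
    rwa [ENNReal.toReal_mul, ENNReal.toReal_mul, ENNReal.toReal_add hA.ne hcI, hcB] at this
  have hsum : ∑ l, (s₀.deficit l : ℝ) ≤ K * s₀.deficit l := by
    have := Finset.sum_le_card_nsmul Finset.univ (fun l => (s₀.deficit l : ℝ)) (s₀.deficit l)
      fun l' hl' => by exact_mod_cast hl l' hl'
    simpa using this
  have hKR : (0 : ℝ) < K := by exact_mod_cast hK
  have hw : (2 * B * ρ / ε + B) / (ρ * p l₀) ≤ s₀.deficit l :=
    le_of_mul_le_mul_left (hs₀.trans hsum) hKR
  rw [div_le_iff₀ (mul_pos hρpos (hppos l₀))] at hw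
  have hpl : p l₀ ≤ p l := hl₀ l (Finset.mem_univ l)
  have hAbig : 2 * B * ρ / ε ≤ A.toReal := by
    have : (s₀.deficit l : ℝ) * (ρ * p l₀) ≤ ρ * s₀.deficit l * p l := by
      rw [← mul_assoc, mul_comm (s₀.deficit l : ℝ)]
      gcongr
    linarith
  rw [div_le_iff₀ hε] at hAbig
  -- Multiplying `hadd'` by `ρ - ε` requires it to be nonnegative; otherwise the claim is trivial.
  rcases le_total (ρ : ℝ) ε with hρε | hρε
  · exact (mul_nonpos_of_nonpos_of_nonneg (sub_nonpos.2 hρε) ENNReal.toReal_nonneg).trans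
      ENNReal.toReal_nonneg
  · have h1 := mul_le_mul_of_nonneg_left hadd' (sub_nonneg.2 hρε)
    have h2 : (ρ - ε) * (A.toReal + 2 * B) ≤ ρ * A.toReal := by
      nlinarith [mul_nonneg hε.le hB0]
    have h3 : (ρ : ℝ) * ((ρ - ε) * M.toReal) ≤ ρ * A.toReal := by
      linarith
    exact le_of_mul_le_mul_left h3 hρpos
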